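/- Let $K$ be an imaginary quadratic field of class number one with ring of integers $O$, let $p$ be an odd rational prime that is inert in $K$, let $N\in O$ be nonzero (for instance a positive integer), and let $$\Gamma=\Gamma_1(Np)=\left\{\begin{pmatrix}a&b\\c&d\end{pmatrix}\in SL_2(O): c\equiv 0,\ a\equiv d\equiv 1 \pmod{Np}\right\}.$$ Suppose that $\Gamma$ is generated by $m$ elements (for example, let $m$ be the minimal number of generators of $\Gamma$). For an integer $g\ge 0$ let $S_g(O^2)$ be the module of homogeneous polynomials of degree $g$ in $O[x,y]$, on which $\begin{pmatrix}a&b\\c&d\end{pmatrix}\in M_2(O)$ acts by $f(x,y)\mapsto f(ax+cy,\,bx+dy)$, and let $S_{g,g}(O)=S_g(O^2)\otimes_O S_g(O^2)$, where $\gamma\in M_2(O)$ acts naturally on the first factor and through the complex conjugate $\overline{\gamma}$ on the second. Let $L_g$ be the quotient of $H^1(\Gamma,S_{g,g}(O))$ by its torsion submodule, and let $T_p$ be the Hecke operator on $L_g$ induced by sending a cocycle $\phi$ to the cocycle $$\delta\mapsto\sum_{u}\alpha_u\,\phi(\alpha_u^{-1}\delta\,\alpha_{v_u}),\qquad \alpha_u=\begin{pmatrix}p&u\\0&1\end{pmatrix},$$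 where $u$ runs over representatives of $O/pO$ and $v_u$ is the unique representative $v$ with $\alpha_u^{-1}\delta\alpha_{v}\in\Gamma$. Fix an embedding of $K$ in $\overline{\mathbb{Q}}_p$, let $v_p$ be the valuation of $\overline{\mathbb{Q}}_p$ with $v_p(p)=1$, and let $\sum_{i=0}^{t}c_iX^{t-i}$ be the characteristic polynomial of $T_p$ on $L_g\otimes_O K$, where $t$ is the rank of $L_g$. The Newton polygon of $T_p$ on $L_g$ is the lower boundary of the convex hull of the points $(i,v_p(c_i))$ with $0\le i\le t$ and $c_i\ne 0$. For real $\alpha\ge 0$ let $D(g,\alpha)$ be the number of nonzero eigenvalues of $T_p$ in $\overline{\mathbb{Q}}_p$, counted with multiplicity as roots of the characteristic polynomial, whose valuation is $\alpha$. Then, for every $g\ge 0$: 1. the Newton polygon of $T_p$ on $L_g$ lies on or above the graph of the continuous piecewise linear function on $[0,\infty)$ that vanishes at $0$ and has slope $r$ on $[r^2m,(r+1)^2m]$ for every integer $r\ge 0$; 2. for every real $\alpha\ge 0$, $$D(g,\alpha)<\left\lfloor\frac{3m(\alpha+1)^2}{2}\right\rfloor m.$$ In particular $D(g,\alpha)$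 is bounded independently of the weight $g$. -/

import Mathlib

open scoped TensorProduct MatrixGroups

noncomputable section

namespace Bianchi

section Levels

variable {R : Type*} [CommRing R]

/-- `Γ₁(I)`: the matrices `(a b; c d)` in `SL₂(R)` with `c ∈ I` and `a ≡ d ≡ 1 mod I`. -/
def Gamma1 (I : Ideal R) : Subgroup SL(2, R) where
  carrier := {γ | γ 1 0 ∈ I ∧ γ 0 0 - 1 ∈ I ∧ γ 1 1 - 1 ∈ I}
  one_mem' := by simp
  mul_mem' := by
    rintro γ δ ⟨h1, h2, h3⟩ ⟨k1, k2, k3⟩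
    simp only [Set.mem_ofPred_eq, Matrix.SpecialLinearGroup.coe_mul, Matrix.mul_apply,
      Fin.sum_univ_two]
    refine ⟨I.add_mem (I.mul_mem_right _ h1) (I.mul_mem_left _ k1), ?_, ?_⟩
    · have : γ 0 0 * δ 0 0 + γ 0 1 * δ 1 0 - 1
          = (γ 0 0 - 1) * δ 0 0 + (δ 0 0 - 1) + γ 0 1 * δ 1 0 := by ring
      rw [this]
      exact I.add_mem (I.add_mem (I.mul_mem_right _ h2) k2) (I.mul_mem_left _ k1)
    · have : γ 1 0 * δ 0 1 + γ 1 1 * δ 1 1 - 1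
          = γ 1 0 * δ 0 1 + ((γ 1 1 - 1) * δ 1 1 + (δ 1 1 - 1)) := by ring
      rw [this]
      exact I.add_mem (I.mul_mem_right _ h1) (I.add_mem (I.mul_mem_right _ h3) k3)
  inv_mem' := by
    rintro γ ⟨h1, h2, h3⟩
    simpa [Matrix.SpecialLinearGroup.coe_inv, Matrix.adjugate_fin_two] using ⟨h1, h3, h2⟩

end Levels

section Coefficients

variable {R : Type*} [CommRing R]

/-- The substitution `x ↦ a x + c y`, `y ↦ b x + d y` attached to `α = (a b; c d)`. -/
def substAlgHom (α : Matrix (Fin 2) (Fin 2) R) :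
    MvPolynomial (Fin 2) R →ₐ[R] MvPolynomial (Fin 2) R :=
  MvPolynomial.aeval fun j => ∑ i, MvPolynomial.C (α i j) * MvPolynomial.X i

lemma substAlgHom_X (α : Matrix (Fin 2) (Fin 2) R) (j : Fin 2) :
    substAlgHom α (MvPolynomial.X j) = ∑ i, MvPolynomial.C (α i j) * MvPolynomial.X i := by
  simp [substAlgHom]

lemma substAlgHom_one : substAlgHom (1 : Matrix (Fin 2) (Fin 2) R) = AlgHom.id R _ := by
  ext j : 1
  rw [substAlgHom_X]
  fin_cases j <;> simp [Matrix.one_apply]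

lemma substAlgHom_mul (α β : Matrix (Fin 2) (Fin 2) R) :
    substAlgHom (α * β) = (substAlgHom α).comp (substAlgHom β) := by
  ext j : 1
  simp only [AlgHom.comp_apply, substAlgHom_X, Fin.sum_univ_two, Matrix.mul_apply, map_add,
    map_mul, MvPolynomial.algHom_C, MvPolynomial.algebraMap_eq]
  ring

lemma substAlgHom_mem (g : ℕ) (α : Matrix (Fin 2) (Fin 2) R) (f : MvPolynomial (Fin 2) R)
    (hf : f ∈ MvPolynomial.homogeneousSubmodule (Fin 2) R g) :
    substAlgHom α f ∈ MvPolynomial.homogeneousSubmodule (Fin 2) R g := by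
  rw [MvPolynomial.mem_homogeneousSubmodule] at hf ⊢
  have := MvPolynomial.IsHomogeneous.aeval hf
    (fun j => ∑ i, MvPolynomial.C (α i j) * MvPolynomial.X i) (n := 1) (fun j =>
      MvPolynomial.IsHomogeneous.sum _ _ _ fun i _ => MvPolynomial.isHomogeneous_C_mul_X _ _)
  simpa [substAlgHom] using this

/-- `S_g(R²)`: homogeneous polynomials of degree `g` in `x, y`. -/
abbrev Sym (R : Type*) [CommRing R] (g : ℕ) : Type _ :=
  MvPolynomial.homogeneousSubmodule (Fin 2) R g

/-- The action `(α f)(x, y) = f(a x + c y, b x + d y)` of `M₂(R)` on `S_g(R²)`. -/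
def symRep (R : Type*) [CommRing R] (g : ℕ) :
    Representation R (Matrix (Fin 2) (Fin 2) R) (Sym R g) where
  toFun α := (substAlgHom α).toLinearMap.restrict (substAlgHom_mem g α)
  map_one' := by
    ext f : 2
    simp [substAlgHom_one]
  map_mul' α β := by
    ext f : 2
    simp only [substAlgHom_mul]
    rfl

/-- `S_{g,g}(R) = S_g(R²) ⊗ S_g(R²)`, where `M₂(R)` acts on the first factor naturally and
on the second factor through the ring endomorphism `σ`. -/
def symRep₂ (σ : R →+* R) (g : ℕ) :
    Representation R (Matrix (Fin 2) (Fin 2) R) (Sym R g ⊗[R] Sym R g) :=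
  (symRep R g).tprod ((symRep R g).comp σ.mapMatrix.toMonoidHom)

end Coefficients

section Cohomology

open NumberField groupCohomology

universe u

section General

variable {k Γ : Type u} [CommRing k] [Group Γ] {M : Type*} [Monoid M]
  {V : Type u} [AddCommGroup V] [Module k V] (ρ : Representation k M V) (j : Γ →* M)
  {U : Type*} [Fintype U] (α : U → M) (elt : Γ → U → Γ)

/-- The map sending `φ : Γ → V` to `δ ↦ ∑_u α_u φ(δ_u)`, where `δ_u = elt δ u`. -/
def heckeFun : (Γ → V) →ₗ[k] (Γ → V) where
  toFun φ δ := ∑ u, ρ (α u) (φ (elt δ u))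
  map_add' φ ψ := by
    funext δ
    simp only [Pi.add_apply, map_add, Finset.sum_add_distrib]
  map_smul' c φ := by
    funext δ
    simp only [Pi.smul_apply, map_smul, Finset.smul_sum, RingHom.id_apply]

lemma heckeFun_apply (φ : Γ → V) (δ : Γ) :
    heckeFun ρ α elt φ δ = ∑ u, ρ (α u) (φ (elt δ u)) := rfl

variable {ρ j α elt} {idx : Γ → U → U}

lemma act_swap (hs : ∀ δ u, j δ * α (idx δ u) = α u * j (elt δ u)) (δ : Γ) (u : U) (x : V) :
    ρ (α u) (ρ (j (elt δ u)) x) = ρ (j δ) (ρ (α (idx δ u)) x) := by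
  rw [← Module.End.mul_apply, ← map_mul, ← hs, map_mul, Module.End.mul_apply]

lemma heckeFun_mem_cocycles (hs : ∀ δ u, j δ * α (idx δ u) = α u * j (elt δ u))
    (hm : ∀ δ ε u, elt (δ * ε) u = elt δ u * elt ε (idx δ u))
    (hb : ∀ δ, Function.Bijective (idx δ)) (φ : Γ → V)
    (hφ : φ ∈ cocycles₁ (Rep.of (X := V) (MonoidHom.comp ρ j))) :
    heckeFun ρ α elt φ ∈ cocycles₁ (Rep.of (X := V) (MonoidHom.comp ρ j)) := by
  rw [mem_cocycles₁_iff] at hφ ⊢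
  intro δ ε
  have hφ' : ∀ δ ε, φ (δ * ε) = ρ (j δ) (φ ε) + φ δ := hφ
  change ∑ u, ρ (α u) (φ (elt (δ * ε) u)) =
    ρ (j δ) (∑ u, ρ (α u) (φ (elt ε u))) + ∑ u, ρ (α u) (φ (elt δ u))
  simp only [hm, hφ', map_add, Finset.sum_add_distrib, map_sum, act_swap hs]
  rw [(hb δ).sum_comp fun v => ρ (j δ) (ρ (α v) (φ (elt ε v)))]

lemma heckeFun_mem_coboundaries (hs : ∀ δ u, j δ * α (idx δ u) = α u * j (elt δ u))
    (hb : ∀ δ, Function.Bijective (idx δ)) (φ : Γ → V)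
    (hφ : φ ∈ coboundaries₁ (Rep.of (X := V) (MonoidHom.comp ρ j))) :
    heckeFun ρ α elt φ ∈ coboundaries₁ (Rep.of (X := V) (MonoidHom.comp ρ j)) := by
  obtain ⟨x, rfl⟩ := hφ
  refine ⟨∑ u, ρ (α u) x, ?_⟩
  funext δ
  change ρ (j δ) (∑ u, ρ (α u) x) - ∑ u, ρ (α u) x =
    ∑ u, ρ (α u) (ρ (j (elt δ u)) x - x)
  simp only [map_sub, Finset.sum_sub_distrib, map_sum, act_swap hs]
  rw [(hb δ).sum_comp fun v => ρ (j δ) (ρ (α v) x)]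

variable (A : Rep.{u} k Γ)

lemma H1π_surjective : Function.Surjective (H1π A).hom :=
  (ModuleCat.epi_iff_surjective _).1 inferInstance

/-- The endomorphism of `H¹(Γ, A)` induced by an endomorphism of the functions `Γ → A`
preserving cocycles and coboundaries. -/
def endH1 (F : (Γ → A) →ₗ[k] (Γ → A)) (hZ : ∀ φ ∈ cocycles₁ A, F φ ∈ cocycles₁ A)
    (hB : ∀ φ ∈ coboundaries₁ A, F φ ∈ coboundaries₁ A) : H1 A →ₗ[k] H1 A :=
  ((LinearMap.ker (H1π A).hom).liftQ ((H1π A).hom ∘ₗ F.restrict hZ) (by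
    intro φ hφ
    rw [LinearMap.mem_ker, H1π_eq_zero_iff] at hφ
    rw [LinearMap.mem_ker, LinearMap.comp_apply, H1π_eq_zero_iff]
    exact hB _ hφ)) ∘ₗ
  ((H1π A).hom.quotKerEquivOfSurjective (H1π_surjective A)).symm.toLinearMap

/-- `endH1` sends the class of a cocycle `φ` to the class of `F φ`. -/
lemma endH1_H1π (F : (Γ → A) →ₗ[k] (Γ → A)) (hZ : ∀ φ ∈ cocycles₁ A, F φ ∈ cocycles₁ A)
    (hB : ∀ φ ∈ coboundaries₁ A, F φ ∈ coboundaries₁ A) (φ : cocycles₁ A) :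
    endH1 A F hZ hB ((H1π A).hom φ) = (H1π A).hom (F.restrict hZ φ) := by
  have : ((H1π A).hom.quotKerEquivOfSurjective (H1π_surjective A)).symm
      ((H1π A).hom φ) = Submodule.Quotient.mk φ := by
    rw [LinearEquiv.symm_apply_eq]
    rfl
  rw [endH1, LinearMap.comp_apply, LinearEquiv.coe_coe, this]
  rfl

/-- Evaluation at a generating set is injective on cocycles, so `H¹(Γ, A)` is finitely generated
when `Γ` is finitely generated, `A` is finitely generated and `k` is noetherian. -/
lemma finite_H1 [IsNoetherianRing k] [Module.Finite k A] [Group.FG Γ] :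
    Module.Finite k (H1 A) := by
  obtain ⟨S, hS⟩ := Group.fg_def.1 (inferInstance : Group.FG Γ)
  let ev : cocycles₁ A →ₗ[k] (S → A) :=
    (LinearMap.funLeft k A (Subtype.val : S → Γ)) ∘ₗ (cocycles₁ A).subtype
  have hev : Function.Injective ev := by
    rw [← LinearMap.ker_eq_bot, LinearMap.ker_eq_bot']
    intro φ hφ
    have h0 : ∀ δ : Γ, φ.1 δ = 0 := by
      intro δ
      have hδ : δ ∈ Subgroup.closure (S : Set Γ) := by rw [hS]; trivial
      have hmul := (mem_cocycles₁_iff φ.1).1 φ.2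
      have hone : φ.1 1 = 0 := cocycles₁_map_one φ
      induction hδ using Subgroup.closure_induction with
      | mem x hx => exact congrFun hφ ⟨x, hx⟩
      | one => exact hone
      | mul x y _ _ hx hy => rw [hmul, hx, hy, map_zero, add_zero]
      | inv x _ hx =>
        have := hmul x⁻¹ x
        rw [inv_mul_cancel, hone, hx, map_zero, zero_add] at this
        exact this.symm
    exact Subtype.ext (funext h0)
  have : Module.Finite k (cocycles₁ A) := Module.Finite.of_injective ev hev
  exact Module.Finite.of_surjective (H1π A).hom (H1π_surjective A)

end General

variable (K : Type u) [Field K] [NumberField K]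

/-- An imaginary quadratic field is a CM field. -/
instance [Algebra.IsQuadraticExtension ℚ K] [IsTotallyComplex K] : IsCMField K :=
  IsCMField.ofCMExtension ℚ K

variable (N : 𝓞 K) (p : ℕ)

/-- `Γ = Γ₁(Np)`. -/
abbrev level : Subgroup SL(2, 𝓞 K) := Gamma1 (Ideal.span {N * (p : 𝓞 K)})

/-- The inclusion of `Γ₁(Np)` in `M₂(𝓞 K)`. -/
def levelToMatrix : level K N p →* Matrix (Fin 2) (Fin 2) (𝓞 K) :=
  Matrix.SpecialLinearGroup.coeMonoidHom.comp (level K N p).subtype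

lemma levelToMatrix_apply (δ : level K N p) (i j : Fin 2) :
    levelToMatrix K N p δ i j = (δ : SL(2, 𝓞 K)) i j := rfl

/-- The residue ring `𝓞 K / p`. -/
abbrev Res : Type u := 𝓞 K ⧸ Ideal.span {(p : 𝓞 K)}

/-- The matrix `α_u = (p u; 0 1)`, for a representative `u` of each class modulo `p`. -/
def heckeMat (u : Res K p) : Matrix (Fin 2) (Fin 2) (𝓞 K) := !![(p : 𝓞 K), u.out; 0, 1]

instance [Fact p.Prime] : Finite (Res K p) :=
  Ideal.finiteQuotientOfFreeOfNeBot _ (by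
    simpa [Ideal.span_singleton_eq_bot] using (Fact.out : p.Prime).ne_zero)

instance [Fact p.Prime] : Fintype (Res K p) := Fintype.ofFinite _

variable {K N p}

lemma mk_out (u : Res K p) : (Ideal.Quotient.mk _ u.out : Res K p) = u := Quotient.out_eq u

lemma mk_of_mem_level {x : 𝓞 K} (hx : x ∈ Ideal.span {N * (p : 𝓞 K)}) :
    (Ideal.Quotient.mk _ x : Res K p) = 0 := by
  rw [Ideal.Quotient.eq_zero_iff_mem, Ideal.mem_span_singleton]
  rw [Ideal.mem_span_singleton] at hx
  exact (Dvd.intro_left N rfl).trans hx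

section Swap

variable [Fact p.Prime]

/-- For `δ ∈ Γ` and `u` there are a unique `v` and a unique `δ' ∈ Γ` with `δ α_v = α_u δ'`. -/
lemma existsUnique_swap (δ : level K N p) (u : Res K p) :
    ∃! w : Res K p × level K N p,
      levelToMatrix K N p δ * heckeMat K p w.1 = heckeMat K p u * levelToMatrix K N p w.2 := by
  have hp : (p : 𝓞 K) ≠ 0 := by exact_mod_cast (Fact.out : p.Prime).ne_zero
  obtain ⟨δ, hc, ha, hd⟩ := δ
  have hdet : δ 0 0 * δ 1 1 - δ 0 1 * δ 1 0 = 1 := by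
    have := δ.det_coe
    rwa [Matrix.det_fin_two] at this
  have mc : (Ideal.Quotient.mk _ (δ 1 0) : Res K p) = 0 := mk_of_mem_level hc
  have ma : (Ideal.Quotient.mk _ (δ 0 0) : Res K p) = 1 := by
    have := mk_of_mem_level ha
    rwa [map_sub, map_one, sub_eq_zero] at this
  have md : (Ideal.Quotient.mk _ (δ 1 1) : Res K p) = 1 := by
    have := mk_of_mem_level hd
    rwa [map_sub, map_one, sub_eq_zero] at this
  set v : Res K p := u - Ideal.Quotient.mk _ (δ 0 1) with hv
  have hdvd : (p : 𝓞 K) ∣ δ 0 0 * v.out + δ 0 1 - u.out * (δ 1 0 * v.out + δ 1 1) := by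
    rw [← Ideal.mem_span_singleton, ← Ideal.Quotient.eq_zero_iff_mem]
    simp only [map_sub, map_add, map_mul, ma, mc, md, mk_out]
    rw [hv]; ring
  obtain ⟨t, ht⟩ := hdvd
  let ε : SL(2, 𝓞 K) := ⟨!![δ 0 0 - u.out * δ 1 0, t; p * δ 1 0, δ 1 0 * v.out + δ 1 1], by
    rw [Matrix.det_fin_two_of]
    linear_combination hdet + δ 1 0 * ht⟩
  have hε : ε ∈ level K N p := by
    refine ⟨?_, ?_, ?_⟩
    · exact Ideal.mul_mem_left _ _ hc
    · have : ε 0 0 - 1 = (δ 0 0 - 1) - u.out * δ 1 0 := by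
        simp only [ε, Matrix.of_apply, Matrix.cons_val]
        ring
      rw [this]
      exact Ideal.sub_mem _ ha (Ideal.mul_mem_left _ _ hc)
    · have : ε 1 1 - 1 = δ 1 0 * v.out + (δ 1 1 - 1) := by
        simp only [ε, Matrix.of_apply, Matrix.cons_val]
        ring
      rw [this]
      exact Ideal.add_mem _ (Ideal.mul_mem_right _ _ hc) hd
  refine ⟨(v, ⟨ε, hε⟩), ?_, ?_⟩
  · refine Matrix.ext fun i j => ?_
    fin_cases i <;> fin_cases j <;>
      simp [Matrix.mul_apply, Fin.sum_univ_two, heckeMat, levelToMatrix_apply, ε]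
    · ring
    · linear_combination ht
    · ring
  · rintro ⟨v', ε', hε'⟩ h
    have e00 := congrFun (congrFun h 0) 0
    have e01 := congrFun (congrFun h 0) 1
    have e10 := congrFun (congrFun h 1) 0
    have e11 := congrFun (congrFun h 1) 1
    simp [Matrix.mul_apply, Fin.sum_univ_two, heckeMat, levelToMatrix_apply] at e00 e01 e10 e11
    have hvv : v' = v := by
      have hpp : (Ideal.Quotient.mk _ (p : 𝓞 K) : Res K p) = 0 :=
        Ideal.Quotient.eq_zero_iff_mem.2 (Ideal.mem_span_singleton_self _)
      have := congrArg (Ideal.Quotient.mk (Ideal.span {(p : 𝓞 K)})) e01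
      rw [← e11] at this
      simp only [map_add, map_mul, ma, mc, md, mk_out, hpp] at this
      rw [hv]
      linear_combination this
    subst hvv
    rw [Prod.mk.injEq]
    refine ⟨rfl, Subtype.ext (Subtype.ext (Matrix.ext fun i j => ?_))⟩
    fin_cases i <;> fin_cases j <;> simp [ε]
    · apply mul_left_cancel₀ hp
      linear_combination -e00 + u.out * e10
    · apply mul_left_cancel₀ hp
      linear_combination -e01 + ht + u.out * e11
    · linear_combination -e10
    · linear_combination -e11

/-- The unique index `v` such that `α_u⁻¹ δ α_v ∈ Γ`. -/
def swapIdx (δ : level K N p) (u : Res K p) : Res K p := (existsUnique_swap δ u).choose.1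

/-- The element `α_u⁻¹ δ α_v` of `Γ`, where `v` is the unique index for which it lies in `Γ`. -/
def swapElt (δ : level K N p) (u : Res K p) : level K N p := (existsUnique_swap δ u).choose.2

lemma swap_spec (δ : level K N p) (u : Res K p) :
    levelToMatrix K N p δ * heckeMat K p (swapIdx δ u) =
      heckeMat K p u * levelToMatrix K N p (swapElt δ u) :=
  (existsUnique_swap δ u).choose_spec.1

lemma swap_unique {δ : level K N p} {u v : Res K p} {ε : level K N p}
    (h : levelToMatrix K N p δ * heckeMat K p v = heckeMat K p u * levelToMatrix K N p ε) :
    v = swapIdx δ u ∧ ε = swapElt δ u := by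
  have := (existsUnique_swap δ u).choose_spec.2 (v, ε) h
  exact ⟨congrArg Prod.fst this, congrArg Prod.snd this⟩

lemma swap_mul (δ ε : level K N p) (u : Res K p) :
    swapElt (δ * ε) u = swapElt δ u * swapElt ε (swapIdx δ u) := by
  refine (swap_unique (v := swapIdx ε (swapIdx δ u)) ?_).2.symm
  rw [map_mul, map_mul, mul_assoc, swap_spec, ← mul_assoc, swap_spec, mul_assoc]

lemma swapIdx_bijective (δ : level K N p) : Function.Bijective (swapIdx δ) := by
  rw [← Finite.injective_iff_bijective]
  refine Function.LeftInverse.injective (g := swapIdx δ⁻¹) fun u => ?_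
  refine (swap_unique (ε := (swapElt δ u)⁻¹) ?_).1.symm
  have h := swap_spec δ u
  have h1 : levelToMatrix K N p δ⁻¹ * levelToMatrix K N p δ = 1 := by
    rw [← map_mul, inv_mul_cancel, map_one]
  have h2 : levelToMatrix K N p (swapElt δ u) * levelToMatrix K N p (swapElt δ u)⁻¹ = 1 := by
    rw [← map_mul, mul_inv_cancel, map_one]
  calc levelToMatrix K N p δ⁻¹ * heckeMat K p u
      = levelToMatrix K N p δ⁻¹ * (heckeMat K p u * levelToMatrix K N p (swapElt δ u)) *
          levelToMatrix K N p (swapElt δ u)⁻¹ := by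
        rw [mul_assoc, mul_assoc (heckeMat K p u), h2, mul_one]
    _ = heckeMat K p (swapIdx δ u) * levelToMatrix K N p (swapElt δ u)⁻¹ := by
        rw [← h, ← mul_assoc, h1, one_mul]

end Swap

variable (K N p)
variable [Algebra.IsQuadraticExtension ℚ K] [IsTotallyComplex K]

/-- Complex conjugation on the ring of integers. -/
def conj : 𝓞 K →+* 𝓞 K := (IsCMField.ringOfIntegersComplexConj K : 𝓞 K →+* 𝓞 K)

/-- `S_{g,g}(𝓞 K)` with its action of `M₂(𝓞 K)`: natural on the first factor, and through
complex conjugation on the second. -/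
abbrev weightAct (g : ℕ) : Representation (𝓞 K) (Matrix (Fin 2) (Fin 2) (𝓞 K))
    (Sym (𝓞 K) g ⊗[𝓞 K] Sym (𝓞 K) g) :=
  symRep₂ (conj K) g

/-- `S_{g,g}(𝓞 K)` as a representation of `Γ₁(Np)`. -/
abbrev weightRep (g : ℕ) : Rep.{u} (𝓞 K) (level K N p) :=
  Rep.of (X := Sym (𝓞 K) g ⊗[𝓞 K] Sym (𝓞 K) g)
    (MonoidHom.comp (weightAct K g) (levelToMatrix K N p))

variable [Fact p.Prime]

/-- `T_p` on `H¹(Γ, S_{g,g}(𝓞 K))`, induced on cocycles by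
`(T_p φ)(δ) = ∑_u α_u φ(α_u⁻¹ δ α_{v_u})`. -/
def heckeH1 (g : ℕ) : H1 (weightRep K N p g) →ₗ[𝓞 K] H1 (weightRep K N p g) :=
  endH1 (weightRep K N p g) (heckeFun (weightAct K g) (heckeMat K p) swapElt)
    (heckeFun_mem_cocycles swap_spec swap_mul swapIdx_bijective)
    (heckeFun_mem_coboundaries swap_spec swapIdx_bijective)

/-- The space of forms of weight `g`: `H¹(Γ, S_{g,g}(𝓞 K))` modulo torsion. -/
abbrev Forms (g : ℕ) : Type u :=
  H1 (weightRep K N p g) ⧸ Submodule.torsion (𝓞 K) (H1 (weightRep K N p g))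

/-- The operator `T_p` on the space of forms of weight `g`. -/
def heckeT (g : ℕ) : Forms K N p g →ₗ[𝓞 K] Forms K N p g :=
  Submodule.mapQ _ _ (heckeH1 K N p g) (by
    rintro x ⟨a, ha⟩
    refine ⟨a, ?_⟩
    rw [Submonoid.smul_def] at ha ⊢
    rw [← map_smul, ha, map_zero])

/-- The space of forms is finitely generated if `Γ` is. -/
instance [Group.FG (level K N p)] (g : ℕ) : Module.Finite (𝓞 K) (Forms K N p g) := by
  have h1 : Module.Finite (𝓞 K) (Sym (𝓞 K) g) :=
    Module.Finite.iff_fg.2 (MvPolynomial.homogeneousSubmodule_fg (Fin 2) (𝓞 K) g)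
  have h2 : Module.Finite (𝓞 K) (weightRep K N p g) :=
    inferInstanceAs (Module.Finite (𝓞 K) (Sym (𝓞 K) g ⊗[𝓞 K] Sym (𝓞 K) g))
  have h3 := finite_H1 (weightRep K N p g)
  exact Module.Finite.of_surjective (Submodule.mkQ _) (Submodule.mkQ_surjective _)

/-- The characteristic polynomial of `T_p` on the space of forms of weight `g`, over `K`. -/
def heckePoly [Group.FG (level K N p)] (g : ℕ) : Polynomial K :=
  ((heckeT K N p g).baseChange K).charpoly

end Cohomology

section Slopes

open Polynomial

variable {p : ℕ} [Fact p.Prime]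

/-- The `p`-adic valuation on the algebraic closure of `ℚ_p`, with `v(p) = 1`
(only used for nonzero arguments). -/
def val (x : PadicAlgCl p) : ℝ := -Real.logb p ‖x‖

/-- For `P = ∑ c_i X^{t-i}` of degree `t`, the points `(i, v(c_i))` with `0 ≤ i ≤ t`
and `c_i ≠ 0`. -/
def newtonPoints (P : (PadicAlgCl p)[X]) : Set (ℝ × ℝ) :=
  {q | ∃ i ≤ P.natDegree, P.coeff (P.natDegree - i) ≠ 0 ∧
    q = ((i : ℝ), val (P.coeff (P.natDegree - i)))}

/-- The Newton polygon: the lower boundary of the convex hull of the Newton points. -/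
def newtonPolygon (P : (PadicAlgCl p)[X]) : Set (ℝ × ℝ) :=
  {q | q ∈ convexHull ℝ (newtonPoints P) ∧
    ∀ y : ℝ, (q.1, y) ∈ convexHull ℝ (newtonPoints P) → q.2 ≤ y}

open Classical in
/-- The number of nonzero roots of `P` of valuation `α`, counted with multiplicity. -/
def slopeCount (P : (PadicAlgCl p)[X]) (α : ℝ) : ℕ :=
  (P.roots.filter fun x => x ≠ 0 ∧ val x = α).card

/-- The piecewise linear function on `[0, ∞)` vanishing at `0` and of slope `r` on
`[r² m, (r+1)² m]` for every `r = 0, 1, 2, …`. -/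
def lowerBound (m : ℕ) (x : ℝ) : ℝ :=
  ⌊√(x / m)⌋₊ * x - m * ∑ k ∈ Finset.range (⌊√(x / m)⌋₊ + 1), (k : ℝ) ^ 2

lemma lowerBound_zero (m : ℕ) : lowerBound m 0 = 0 := by
  simp [lowerBound]

lemma lowerBound_sub (m r : ℕ) (hm : 0 < m) {x y : ℝ}
    (hx : x ∈ Set.Icc ((r : ℝ) ^ 2 * m) ((r + 1 : ℝ) ^ 2 * m))
    (hy : y ∈ Set.Icc ((r : ℝ) ^ 2 * m) ((r + 1 : ℝ) ^ 2 * m)) :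
    lowerBound m y - lowerBound m x = r * (y - x) := by
  have key : ∀ z ∈ Set.Icc ((r : ℝ) ^ 2 * m) ((r + 1 : ℝ) ^ 2 * m),
      lowerBound m z = r * z - m * ∑ k ∈ Finset.range (r + 1), (k : ℝ) ^ 2 := by
    rintro z ⟨h1, h2⟩
    have hm' : (0 : ℝ) < m := by exact_mod_cast hm
    rcases h2.lt_or_eq with h2 | h2
    · have : ⌊√(z / m)⌋₊ = r := by
        rw [Nat.floor_eq_iff (Real.sqrt_nonneg _)]
        constructor
        · exact Real.le_sqrt_of_sq_le ((le_div_iff₀ hm').2 h1)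
        · rw [Real.sqrt_lt' (by positivity)]
          exact (div_lt_iff₀ hm').2 h2
      rw [lowerBound, this]
    · have : ⌊√(z / m)⌋₊ = r + 1 := by
        rw [h2, mul_div_assoc, div_self hm'.ne', mul_one, Real.sqrt_sq (by positivity)]
        exact_mod_cast Nat.floor_natCast (r + 1)
      rw [lowerBound, this, Finset.sum_range_succ _ (r + 1), h2]
      push_cast
      ring
  rw [key x hx, key y hy]
  ring

end Slopes

end Bianchi

end

/-!
The coefficients of the characteristic polynomial of `T_p` are bounded below `p`-adically by
comparing the lattice `L` of forms with sublattices on which `T_p` is very divisible. Write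
`O` for the ring of integers and `S` for `S_{g,g}(O)`.

For `k ≥ 0` let `M_k ⊆ S` be the part of degree `k` of the tensor product of the filtrations of the
two factors by powers of the ideal `(p, x)` (`symFil`, `tensFil`). A matrix of `Γ₁(Np)` is upper
triangular modulo `p`, so `M_k` is stable under `Γ`; the matrix `α_u` maps both `p` and `x` to
multiples of `p`, so `α_u M_k ⊆ p^k S`. The monomial `xⁱy^(g-i) ⊗ xʲy^(g-j)` times `p^(k-i-j)` lies
in `M_k`, so `S / M_k` has at most `q ^ (1² + ⋯ + k²)` elements, where `q = #(O / p)`, whatever `g`.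

Let `L' ⊆ L` consist of the classes of cocycles with values in `M_k`. Then `T_p L' ⊆ p^k L`, since
a cocycle divisible by `p^k` as a function is `p^k` times a cocycle. As a cocycle modulo `M_k` is
determined by its values on `m` generators, `L / L'` has at most `q ^ (m (1² + ⋯ + k²))` elements
(`pow_dvd_coeff_charpoly_of_cochains`). Now `O` is principal, so there is a Smith normal form
`B` of `L'` in `L`, and if `A` is the matrix of `T_p`, then `A B = p^k C`. Comparing coefficients
in `det (X - A) det B = det (X B - p^k C)` gives, for every `k`, that `v(c_i)` is at least
`k i - m (1² + ⋯ + k²)` (`prime_pow_dvd_coeff_charpoly`).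

The function `lowerBound m` is the maximum of these lines, which is the statement about the Newton
polygon. For the slopes, let `D` be the number of nonzero eigenvalues of valuation at most `α`. In
the elementary symmetric function `e_D` of the eigenvalues their product dominates
(`norm_esymm_card_filter`), so `v(c_D) ≤ α D`, and the line with `k` near the square root of
`⌊3m(α+1)²/2⌋` bounds `D` (`lt_floor_mul_of_forall_le`). The last step needs `m ≥ 2`, which holds
because `Γ` is not commutative (`two_le_of_closure_eq_top`).
-/

noncomputable section

namespace Bianchi

/-! ### Divisibility of the coefficients of a characteristic polynomial -/

section CharpolyDivisibility

open Polynomial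

variable {R : Type*} [CommRing R] [IsDomain R]

/-- Compare coefficients in `det B * det (X - A) = det (X B - c C)`, where `X` and `c` enter the
right-hand side homogeneously. -/
lemma pow_dvd_det_mul_coeff_charpoly {n : Type*} [Fintype n] [DecidableEq n]
    (A B C : Matrix n n R) {c : R} (hc : c ≠ 0) (h : A * B = c • C) {i : ℕ}
    (hi : i ≤ Fintype.card n) :
    c ^ i ∣ B.det * A.charpoly.coeff (Fintype.card n - i) := by
  set φ : R[X] →+* R[X] := compRingHom (Polynomial.C c * X) with hφ
  set Q : R[X] := Polynomial.C B.det * A.charpoly with hQ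
  set S : R[X] := ((X : R[X]) • B.map Polynomial.C - C.map Polynomial.C).det with hS
  have hQdet : Q = ((X : R[X]) • B.map Polynomial.C - (c • C).map Polynomial.C).det := by
    rw [hQ, ← h, Matrix.charpoly, mul_comm, RingHom.map_det, ← Matrix.det_mul]
    congr 1
    rw [RingHom.mapMatrix_apply, Matrix.charmatrix, sub_mul, Matrix.scalar_apply,
      ← Matrix.smul_one_eq_diagonal, Matrix.smul_mul, one_mul, RingHom.mapMatrix_apply,
      Matrix.map_mul]
  have hsub : Q.comp (Polynomial.C c * X) = Polynomial.C (c ^ Fintype.card n) * S := by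
    have h1 : Q.comp (Polynomial.C c * X) = φ Q := rfl
    rw [h1, hQdet, RingHom.map_det, hS, map_pow, ← Matrix.det_smul]
    congr 1
    ext a b : 1
    simp [hφ, mul_sub, mul_left_comm]
  have hcoeff := congrArg (fun P => P.coeff (Fintype.card n - i)) hsub
  simp only [comp_C_mul_X_coeff, coeff_C_mul] at hcoeff
  refine ⟨S.coeff (Fintype.card n - i), ?_⟩
  have h2 : Q.coeff (Fintype.card n - i) = B.det * A.charpoly.coeff (Fintype.card n - i) := by
    rw [hQ, coeff_C_mul]
  rw [← h2]
  apply mul_right_cancel₀ (pow_ne_zero (Fintype.card n - i) hc)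
  rw [hcoeff]
  conv_lhs => rw [← Nat.add_sub_cancel' hi, pow_add]
  rw [Nat.add_sub_cancel' hi]
  ring

/-- If `T` maps a submodule `N` containing `π ^ k M` into `π ^ k M` and the quotient `M ⧸ N` has at
most `#(R ⧸ π) ^ ℓ` elements, then the `i`-th coefficient of the characteristic polynomial of `T`
is divisible by `π ^ (k i - ℓ)`. -/
theorem prime_pow_dvd_coeff_charpoly [IsPrincipalIdealRing R]
    [Module.Free ℤ R] [Module.Finite ℤ R]
    {M : Type*} [AddCommGroup M] [Module R M] [Module.Free R M] [Module.Finite R M]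
    (T : M →ₗ[R] M) (N : Submodule R M) {π : R} (hπ : Prime π) (k ℓ : ℕ)
    (hN : ∀ x : M, π ^ k • x ∈ N) (hT : ∀ x ∈ N, ∃ y, T x = π ^ k • y)
    (hcard : Nat.card (M ⧸ N) ≤ Ideal.absNorm (Ideal.span {π}) ^ ℓ) {i : ℕ}
    (hi : i ≤ Module.finrank R M) :
    π ^ (k * i) ∣ π ^ ℓ * T.charpoly.coeff (Module.finrank R M - i) := by
  classical
  have hπk : π ^ k ≠ 0 := pow_ne_zero _ hπ.ne_zero
  let b₀ := Module.Free.chooseBasis R M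
  have hrank : Module.finrank R N = Module.finrank R M := by
    refine le_antisymm (Submodule.finrank_le N) ?_
    refine LinearMap.finrank_le_finrank_of_injective
      (f := (LinearMap.lsmul R M (π ^ k)).codRestrict N hN) ?_
    intro x y hxy
    exact smul_right_injective M hπk (congrArg Subtype.val hxy)
  let a := Submodule.smithNormalFormCoeffs b₀ hrank
  let b := Submodule.smithNormalFormTopBasis b₀ hrank
  let b' := Submodule.smithNormalFormBotBasis b₀ hrank
  have hb' : ∀ j, (b' j : M) = a j • b j := Submodule.smithNormalFormBotBasis_def b₀ hrank
  have hadvd : ∀ j, a j ∣ π ^ k := by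
    intro j
    obtain ⟨c, hc⟩ := b'.mem_submodule_iff'.1 (hN (b j))
    have := congrArg (fun x => b.repr x j) hc
    simp only [hb', ← mul_smul, b.repr_sum_self] at this
    simp only [map_smul, b.repr_self, Finsupp.smul_apply, Finsupp.single_eq_same, smul_eq_mul,
      mul_one] at this
    exact ⟨c j, by rw [this, mul_comm]⟩
  have hprod : ∏ j, a j ∣ π ^ (k * Fintype.card (Module.Free.ChooseBasisIndex R M)) := by
    rw [pow_mul]
    exact (Finset.prod_dvd_prod_of_dvd _ _ fun j _ => hadvd j).trans (by simp)
  obtain ⟨e, -, he⟩ := (dvd_prime_pow hπ _).1 hprod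
  -- The index of `N` is the norm of the product of the elementary divisors.
  have hindex : Nat.card (M ⧸ N) = Ideal.absNorm (Ideal.span {π}) ^ e := by
    rw [Nat.card_congr (N.quotientEquivPiSpan b₀ hrank).toEquiv, Nat.card_pi, ← map_pow,
      Ideal.span_singleton_pow, ← Ideal.span_singleton_eq_span_singleton.2 he,
      ← Ideal.prod_span_singleton, map_prod]
    rfl
  have hq : 1 < Ideal.absNorm (Ideal.span {π}) := by
    have h0 : Ideal.absNorm (Ideal.span {π}) ≠ 0 := by
      rw [Ne, Ideal.absNorm_eq_zero_iff, Ideal.span_singleton_eq_bot]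
      exact hπ.ne_zero
    have h1 : Ideal.absNorm (Ideal.span {π}) ≠ 1 := by
      rw [Ne, Ideal.absNorm_eq_one_iff, Ideal.span_singleton_eq_top]
      exact hπ.not_isUnit
    omega
  have hel : e ≤ ℓ := by
    rw [hindex] at hcard
    exact (Nat.pow_le_pow_iff_right hq).1 hcard
  choose y hy using fun j => hT (b' j) (b' j).2
  have hmat : LinearMap.toMatrix b b T * Matrix.diagonal a =
      π ^ k • Matrix.of fun r j => b.repr (y j) r := by
    ext r j
    have := congrArg (fun x => b.repr x r) (hy j)
    simp only [hb', map_smul, Finsupp.smul_apply, smul_eq_mul] at this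
    rw [Matrix.mul_diagonal, LinearMap.toMatrix_apply, Matrix.smul_apply, Matrix.of_apply,
      smul_eq_mul, ← this, mul_comm]
  have hfin : Module.finrank R M = Fintype.card (Module.Free.ChooseBasisIndex R M) :=
    Module.finrank_eq_card_basis b
  rw [hfin] at hi ⊢
  have key := pow_dvd_det_mul_coeff_charpoly _ _ _ hπk hmat hi
  rw [LinearMap.charpoly_toMatrix, Matrix.det_diagonal, ← pow_mul] at key
  refine key.trans (mul_dvd_mul_right ?_ _)
  exact he.dvd.trans (pow_dvd_pow _ hel)

end CharpolyDivisibility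

/-! ### Slopes of polynomials over the algebraic closure of `ℚ_p` -/

section Slopes

open Polynomial

variable {p : ℕ} [Fact p.Prime]

lemma norm_natCast_prime : ‖(p : PadicAlgCl p)‖ = (p : ℝ)⁻¹ := by
  rw [← PadicAlgCl.valuation_coe, PadicAlgCl.valuation_p]
  simp

lemma one_lt_prime : (1 : ℝ) < p := by exact_mod_cast (Fact.out : p.Prime).one_lt

lemma norm_eq_rpow_neg_val {x : PadicAlgCl p} (hx : x ≠ 0) : ‖x‖ = (p : ℝ) ^ (-val x) := by
  rw [val, neg_neg, Real.rpow_logb (by linarith [one_lt_prime (p := p)])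
    one_lt_prime.ne' (norm_pos_iff.2 hx)]

lemma val_le_iff {x : PadicAlgCl p} (hx : x ≠ 0) (a : ℝ) : val x ≤ a ↔ (p : ℝ) ^ (-a) ≤ ‖x‖ := by
  rw [norm_eq_rpow_neg_val hx, Real.rpow_le_rpow_left_iff one_lt_prime, neg_le_neg_iff]

lemma le_val_iff {x : PadicAlgCl p} (hx : x ≠ 0) (a : ℝ) : a ≤ val x ↔ ‖x‖ ≤ (p : ℝ) ^ (-a) := by
  rw [norm_eq_rpow_neg_val hx, Real.rpow_le_rpow_left_iff one_lt_prime, neg_le_neg_iff]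

lemma norm_le_one_of_isIntegral {x : PadicAlgCl p} (hx : IsIntegral ℤ x) : ‖x‖ ≤ 1 := by
  have h := Valuation.Integers.mem_of_integral
    (Valuation.integer.integers (Valued.v : Valuation (PadicAlgCl p) NNReal))
    (x := x) (hx.tower_top)
  rw [Valuation.mem_integer_iff, PadicAlgCl.valuation_def] at h
  exact_mod_cast h

/-- A divisibility `p ^ a ∣ p ^ b c` between algebraic integers bounds the `p`-adic valuation of `c`
from below by `a - b`. -/
lemma sub_le_val_of_pow_dvd {K : Type*} [Field K] (ι : K →+* PadicAlgCl p)
    {c : NumberField.RingOfIntegers K} {a b : ℕ}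
    (h : (p : NumberField.RingOfIntegers K) ^ a ∣ (p : NumberField.RingOfIntegers K) ^ b * c)
    (hc : ι (algebraMap _ K c) ≠ 0) :
    (a : ℝ) - b ≤ val (ι (algebraMap _ K c)) := by
  obtain ⟨d, hd⟩ := h
  have hp0 : (0 : ℝ) < p := by linarith [one_lt_prime (p := p)]
  have hd1 : ‖ι (algebraMap _ K d)‖ ≤ 1 :=
    norm_le_one_of_isIntegral (d.isIntegral_coe.map ι.toIntAlgHom)
  have h1 := congrArg (fun x => ‖ι (algebraMap _ K x)‖) hd
  simp only [map_mul, map_pow, map_natCast, norm_mul, norm_pow, norm_natCast_prime] at h1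
  rw [le_val_iff hc, neg_sub, Real.rpow_sub hp0, Real.rpow_natCast, Real.rpow_natCast,
    le_div_iff₀ (by positivity)]
  have h2 : ((p : ℝ)⁻¹) ^ b * ‖ι (algebraMap _ K c)‖ ≤ ((p : ℝ)⁻¹) ^ a := by
    rw [h1]
    exact mul_le_of_le_one_right (by positivity) hd1
  rw [inv_pow, inv_pow, inv_mul_le_iff₀ (by positivity), ← div_eq_mul_inv,
    le_div_iff₀ (by positivity)] at h2
  exact h2

/-- The value of `lowerBound m` at `x` is that of one of the lines `k x - m (1² + ⋯ + k²)`, and a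
line lying below the Newton points lies below their convex hull. -/
lemma lowerBound_le_of_mem_newtonPolygon {m : ℕ} {P : (PadicAlgCl p)[X]}
    (H : ∀ k i : ℕ, i ≤ P.natDegree → P.coeff (P.natDegree - i) ≠ 0 →
      (k : ℝ) * i - m * ∑ j ∈ Finset.range (k + 1), (j : ℝ) ^ 2 ≤
        val (P.coeff (P.natDegree - i)))
    {q : ℝ × ℝ} (hq : q ∈ newtonPolygon P) : lowerBound m q.1 ≤ q.2 := by
  rw [lowerBound]
  set k := ⌊√(q.1 / m)⌋₊
  set c : ℝ := m * ∑ j ∈ Finset.range (k + 1), (j : ℝ) ^ 2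
  have hconv : Convex ℝ {q : ℝ × ℝ | (k : ℝ) * q.1 - q.2 ≤ c} :=
    convex_halfSpace_le (f := fun q : ℝ × ℝ => (k : ℝ) * q.1 - q.2)
      ⟨fun x y => by simp; ring, fun a x => by simp; ring⟩ c
  have hsub : newtonPoints P ⊆ {q : ℝ × ℝ | (k : ℝ) * q.1 - q.2 ≤ c} := by
    rintro q ⟨i, hi, h0, rfl⟩
    have := H k i hi h0
    simp only [Set.mem_ofPred_eq]
    linarith
  have := convexHull_min hsub hconv hq.1
  simp only [Set.mem_ofPred_eq] at this
  linarith

lemma esymm_cons {R : Type*} [CommRing R] (x : R) (s : Multiset R) (n : ℕ) :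
    (x ::ₘ s).esymm (n + 1) = s.esymm (n + 1) + x * s.esymm n := by
  simp only [Multiset.esymm, Multiset.powersetCard_cons, Multiset.map_add, Multiset.sum_add,
    Multiset.map_map]
  congr 1
  rw [← Multiset.sum_map_mul_left]
  simp

open Classical in
/-- If `a` elements of `s` have norm at least `c`, with product of norms `π`, then among the
terms of `‖e_n(s)‖ c⁻ⁿ` the one for `n = a` is the last maximal one, and `‖e_a(s)‖ = π`. -/
lemma norm_esymm_card_filter {F : Type*} [NormedField F] [IsUltrametricDist F] {c : ℝ} (hc : 0 < c)
    (s : Multiset F) :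
    let A := s.filter fun x => c ≤ ‖x‖
    let π := (A.map norm).prod
    (∀ n, ‖s.esymm n‖ * c ^ A.card ≤ π * c ^ n) ∧ ‖s.esymm A.card‖ = π ∧
      ∀ n, A.card < n → ‖s.esymm n‖ * c ^ A.card < π * c ^ n := by
  intro A π
  have h0 : ∀ s : Multiset F, s.esymm 0 = 1 := fun s => by simp [Multiset.esymm]
  induction s using Multiset.induction_on with
  | empty =>
    have hA : A = 0 := by simp [A]
    have hπ : π = 1 := by simp [π, hA]
    have hs : ∀ n, (0 : Multiset F).esymm (n + 1) = 0 := fun n => by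
      simp [Multiset.esymm, Multiset.powersetCard_zero_right]
    simp only [hA, hπ, Multiset.card_zero, pow_zero, mul_one, one_mul, h0, norm_one, true_and]
    refine ⟨fun n => ?_, fun n hn => ?_⟩
    · cases n with
      | zero => simp [h0]
      | succ n => rw [hs, norm_zero]; positivity
    · obtain ⟨n, rfl⟩ := Nat.exists_eq_succ_of_ne_zero hn.ne'
      rw [Nat.succ_eq_add_one, hs, norm_zero]; positivity
  | cons x s ih =>
    set A₀ := s.filter fun x => c ≤ ‖x‖ with hA₀
    set π₀ := (A₀.map norm).prod with hπ₀
    obtain ⟨ih1, ih2, ih3⟩ := ih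
    have hca : c ^ A₀.card ≤ π₀ := by simpa [h0] using ih1 0
    have hπpos : 0 < π₀ := lt_of_lt_of_le (by positivity) hca
    have hmax : ∀ n, ‖(x ::ₘ s).esymm (n + 1)‖ ≤ max ‖s.esymm (n + 1)‖ (‖x‖ * ‖s.esymm n‖) := by
      intro n
      rw [esymm_cons, ← norm_mul]
      exact IsUltrametricDist.norm_add_le_max _ _
    -- A large `x` raises `a` by one and its term `x e_a` dominates; a small `x` changes no maximum.
    by_cases hx : c ≤ ‖x‖
    · have hA : A = x ::ₘ A₀ := by simp [A, hx, hA₀]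
      have hπ : π = ‖x‖ * π₀ := by simp [π, hA, hπ₀]
      have hcard : A.card = A₀.card + 1 := by simp [hA]
      have hxpos : 0 < ‖x‖ := hc.trans_le hx
      rw [hcard, hπ]
      have e1 : ∀ n, π₀ * c ^ (n + 1) * c ≤ ‖x‖ * π₀ * c ^ (n + 1) := fun n => by
        calc _ = c * (π₀ * c ^ (n + 1)) := by ring
          _ ≤ ‖x‖ * (π₀ * c ^ (n + 1)) := by gcongr
          _ = _ := by ring
      refine ⟨fun n => ?_, ?_, fun n hn => ?_⟩
      · cases n with
        | zero =>
          rw [h0, norm_one, one_mul, pow_zero, mul_one, pow_succ, mul_comm]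
          gcongr
        | succ n =>
          refine (mul_le_mul_of_nonneg_right (hmax n) (by positivity)).trans ?_
          rw [max_mul_of_nonneg _ _ (by positivity)]
          refine max_le ?_ ?_
          · rw [pow_succ c A₀.card, ← mul_assoc]
            exact (mul_le_mul_of_nonneg_right (ih1 _) hc.le).trans (e1 n)
          · calc _ = ‖x‖ * c * (‖s.esymm n‖ * c ^ A₀.card) := by ring
              _ ≤ ‖x‖ * c * (π₀ * c ^ n) := mul_le_mul_of_nonneg_left (ih1 n) (by positivity)
              _ = _ := by ring
      · rw [esymm_cons]
        have h1 : ‖x * s.esymm A₀.card‖ = ‖x‖ * π₀ := by rw [norm_mul, ih2]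
        have h2 : ‖s.esymm (A₀.card + 1)‖ < ‖x‖ * π₀ := by
          have h3 := ih3 (A₀.card + 1) (Nat.lt_succ_self _)
          rw [pow_succ, mul_comm (c ^ A₀.card), ← mul_assoc] at h3
          calc _ < π₀ * c := lt_of_mul_lt_mul_right h3 (by positivity)
            _ ≤ π₀ * ‖x‖ := by gcongr
            _ = _ := mul_comm _ _
        rw [IsUltrametricDist.norm_add_eq_max_of_norm_ne_norm (by rw [h1]; exact h2.ne), h1,
          max_eq_right h2.le]
      · obtain ⟨n, rfl⟩ := Nat.exists_eq_succ_of_ne_zero (by omega : n ≠ 0)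
        rw [Nat.succ_eq_add_one] at hn ⊢
        refine (mul_le_mul_of_nonneg_right (hmax n) (by positivity)).trans_lt ?_
        rw [max_mul_of_nonneg _ _ (by positivity)]
        refine max_lt ?_ ?_
        · rw [pow_succ c A₀.card, ← mul_assoc]
          exact (mul_lt_mul_of_pos_right (ih3 _ (by omega)) hc).trans_le (e1 n)
        · calc _ = ‖x‖ * c * (‖s.esymm n‖ * c ^ A₀.card) := by ring
            _ < ‖x‖ * c * (π₀ * c ^ n) :=
                mul_lt_mul_of_pos_left (ih3 n (by omega)) (by positivity)
            _ = _ := by ring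
    · have hA : A = A₀ := by simp [A, hx, hA₀]
      have hπ : π = π₀ := by simp [π, hA, hπ₀]
      rw [hA, hπ]
      rw [not_le] at hx
      have e2 : ∀ n, ‖x‖ * ‖s.esymm n‖ * c ^ A₀.card < π₀ * c ^ (n + 1) := fun n => by
        calc _ = ‖x‖ * (‖s.esymm n‖ * c ^ A₀.card) := by ring
          _ ≤ ‖x‖ * (π₀ * c ^ n) := mul_le_mul_of_nonneg_left (ih1 n) (norm_nonneg x)
          _ < c * (π₀ * c ^ n) := by gcongr
          _ = _ := by ring
      refine ⟨fun n => ?_, ?_, fun n hn => ?_⟩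
      · cases n with
        | zero => simpa [h0] using hca
        | succ n =>
          refine (mul_le_mul_of_nonneg_right (hmax n) (by positivity)).trans ?_
          rw [max_mul_of_nonneg _ _ (by positivity)]
          exact max_le (ih1 _) (e2 n).le
      · rcases hcases : A₀.card with _ | b
        · rw [hcases, h0] at ih2
          rw [h0, ih2]
        · rw [hcases] at ih2
          have h2 : ‖x * s.esymm b‖ < ‖s.esymm (b + 1)‖ := by
            have h3 := e2 b
            rw [hcases] at h3
            rw [norm_mul, ih2]
            exact lt_of_mul_lt_mul_right h3 (by positivity)
          rw [esymm_cons, IsUltrametricDist.norm_add_eq_max_of_norm_ne_norm h2.ne', ih2,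
            max_eq_left (ih2 ▸ h2.le)]
      · obtain ⟨n, rfl⟩ := Nat.exists_eq_succ_of_ne_zero (by omega : n ≠ 0)
        rw [Nat.succ_eq_add_one] at hn ⊢
        refine (mul_le_mul_of_nonneg_right (hmax n) (by positivity)).trans_lt ?_
        rw [max_mul_of_nonneg _ _ (by positivity)]
        exact max_lt (ih3 _ hn) (e2 n)

lemma sum_range_sq (r : ℕ) :
    ∑ j ∈ Finset.range (r + 1), (j : ℝ) ^ 2 = r * (r + 1) * (2 * r + 1) / 6 := by
  induction r with
  | zero => simp
  | succ r ih =>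
    rw [Finset.sum_range_succ, ih]
    push_cast
    ring

/-- A point `(D, α D)` with `m ≥ 2` and `D ≥ ⌊3m(α+1)²/2⌋ m` lies below one of the lines
`k x - m (1² + ⋯ + k²)`. -/
lemma lt_floor_mul_of_forall_le {m D : ℕ} (hm : 2 ≤ m) {α : ℝ} (hα : 0 ≤ α)
    (h : ∀ k : ℕ, (k : ℝ) * D - m * ∑ j ∈ Finset.range (k + 1), (j : ℝ) ^ 2 ≤ α * D) :
    D < ⌊3 * (m : ℝ) * (α + 1) ^ 2 / 2⌋₊ * m := by
  set R := ⌊3 * (m : ℝ) * (α + 1) ^ 2 / 2⌋₊ with hR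
  by_contra! hD
  have hm' : (2 : ℝ) ≤ m := by exact_mod_cast hm
  have hR1 : 3 * (α + 1) ^ 2 < R + 1 := by
    refine lt_of_le_of_lt ?_ (Nat.lt_floor_add_one (3 * (m : ℝ) * (α + 1) ^ 2 / 2))
    nlinarith [sq_nonneg (α + 1)]
  have hR3 : 3 ≤ R := by
    have : (2 : ℝ) < R := by nlinarith
    exact_mod_cast this
  -- The optimal slope is about `√R`.
  set r := Nat.sqrt R
  have hr1 : r * r ≤ R := Nat.sqrt_le R
  have hr2 : R < (r + 1) * (r + 1) := Nat.lt_succ_sqrt R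
  have hr0 : 1 ≤ r := by
    by_contra! h0
    have : r = 0 := by omega
    rw [this] at hr2
    omega
  have hr1' : (r : ℝ) * r ≤ R := by exact_mod_cast hr1
  have hr2' : (R : ℝ) + 1 ≤ (r + 1) * (r + 1) := by exact_mod_cast hr2
  have hr0' : (1 : ℝ) ≤ r := by exact_mod_cast hr0
  have hD' : (R : ℝ) * m ≤ D := by exact_mod_cast hD
  -- `0.578` is slightly more than `1 / √3`.
  have hαr : α + 1 < 0.578 * (r + 1) := by
    by_contra! hcon
    nlinarith
  have hpos : 0 < r - α := by linarith
  have key : (r - α) * R ≤ r * (r + 1) * (2 * r + 1) / 6 := by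
    have h1 := h r
    rw [sum_range_sq] at h1
    have h2 : (r - α) * (R * m) ≤ (r - α) * D := by gcongr
    have h3 : ((r - α) * R) * m ≤ (r * (r + 1) * (2 * r + 1) / 6) * m := by linarith
    exact le_of_mul_le_mul_right h3 (by linarith)
  -- The estimate with `R ≥ r²` suffices from `r = 2` on; for `r = 1` the only value is `R = 3`.
  rcases hr0.eq_or_lt with hr | hr
  · rw [← hr] at hr2 key hr2'
    have hR' : (3 : ℝ) ≤ R := by exact_mod_cast hR3
    norm_num at key hr2'
    have hα2 : α < 2 / 3 := by
      rw [← hr] at hαr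
      norm_num at hαr
      linarith
    nlinarith
  · have hr' : (2 : ℝ) ≤ r := by exact_mod_cast hr
    have h1 : 0.422 * ((r : ℝ) + 1) * (r * r) ≤ (r - α) * R := by
      have : 0.422 * ((r : ℝ) + 1) ≤ r - α := by linarith
      gcongr
    have h2 : 0.422 * ((r : ℝ) + 1) * (r * r) - r * (r + 1) * (2 * r + 1) / 6 =
      (r * (r + 1)) * (0.422 * r - (2 * r + 1) / 6) := by ring
    have h3 : 0 < ((r : ℝ) * (r + 1)) * (0.422 * r - (2 * r + 1) / 6) := by
      apply mul_pos (by positivity)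
      linarith
    linarith

/-- With `D` the number of nonzero roots of valuation at most `α`, the coefficient of index `D` has
valuation at most `α D`. -/
lemma slopeCount_lt {m : ℕ} (hm : 2 ≤ m) {P : (PadicAlgCl p)[X]} (hP : P.Monic)
    (H : ∀ k i : ℕ, i ≤ P.natDegree → P.coeff (P.natDegree - i) ≠ 0 →
      (k : ℝ) * i - m * ∑ j ∈ Finset.range (k + 1), (j : ℝ) ^ 2 ≤
        val (P.coeff (P.natDegree - i)))
    {α : ℝ} (hα : 0 ≤ α) : slopeCount P α < ⌊3 * (m : ℝ) * (α + 1) ^ 2 / 2⌋₊ * m := by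
  classical
  have hp0 : (0 : ℝ) < p := by linarith [one_lt_prime (p := p)]
  set c : ℝ := (p : ℝ) ^ (-α)
  have hc : 0 < c := Real.rpow_pos_of_pos hp0 _
  set A := P.roots.filter fun x => c ≤ ‖x‖ with hA
  obtain ⟨hbound, hnorm, -⟩ := norm_esymm_card_filter hc P.roots
  rw [← hA] at hbound hnorm
  have hle : slopeCount P α ≤ A.card := by
    rw [slopeCount]
    refine Multiset.card_le_card (Multiset.monotone_filter_right _ fun x hx => ?_)
    exact (val_le_iff hx.1 α).1 hx.2.le
  refine hle.trans_lt (lt_floor_mul_of_forall_le hm hα fun k => ?_)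
  have hroots : Multiset.card P.roots = P.natDegree :=
    splits_iff_card_roots.1 (IsAlgClosed.splits P)
  have hcard : A.card ≤ P.natDegree := hroots ▸ Multiset.card_le_card (Multiset.filter_le _ _)
  have hcoeff : ‖P.coeff (P.natDegree - A.card)‖ = (A.map norm).prod := by
    rw [coeff_eq_esymm_roots_of_card hroots (Nat.sub_le _ _), Nat.sub_sub_self hcard,
      hP.leadingCoeff, one_mul, norm_mul, norm_pow, norm_neg, norm_one, one_pow, one_mul, hnorm]
  have hprod : c ^ A.card ≤ (A.map norm).prod := by
    simpa [Multiset.esymm] using hbound 0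
  have h0 : P.coeff (P.natDegree - A.card) ≠ 0 := by
    rw [← norm_pos_iff, hcoeff]
    exact lt_of_lt_of_le (by positivity) hprod
  refine (H k A.card hcard h0).trans ((val_le_iff h0 _).2 ?_)
  rw [hcoeff, ← neg_mul, Real.rpow_mul hp0.le, Real.rpow_natCast]
  exact hprod

end Slopes

/-! ### The filtration of the coefficient modules -/

section Filtration

open MvPolynomial

variable {R : Type*} [CommRing R] (π : R)

/-- The forms of degree `g` in the `a`-th power of the ideal `(π, x)` of `R[x, y]`: the coefficient
of `xⁱ y^(g-i)` is divisible by `π ^ (a - i)`. -/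
def symFil (g a : ℕ) : Submodule R (Sym R g) :=
  ((Ideal.span {C π, X 0} ^ a : Ideal (MvPolynomial (Fin 2) R)).restrictScalars R).comap
    (Submodule.subtype _)

variable {π}

lemma mem_symFil {g a : ℕ} {f : Sym R g} :
    f ∈ symFil π g a ↔
      (f : MvPolynomial (Fin 2) R) ∈ (Ideal.span {C π, X 0} : Ideal (MvPolynomial (Fin 2) R)) ^ a :=
  Iff.rfl

lemma symRep_apply_coe (g : ℕ) (γ : Matrix (Fin 2) (Fin 2) R) (f : Sym R g) :
    (symRep R g γ f : MvPolynomial (Fin 2) R) = substAlgHom γ f := rfl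

lemma symFil_anti (g : ℕ) {a b : ℕ} (h : a ≤ b) : symFil π g b ≤ symFil π g a :=
  fun _ hf => Ideal.pow_le_pow_right h hf

lemma pow_smul_mem_symFil {g a : ℕ} (c : ℕ) {f : Sym R g} (hf : f ∈ symFil π g a) :
    π ^ c • f ∈ symFil π g (c + a) := by
  rw [mem_symFil, Submodule.coe_smul, smul_eq_C_mul, pow_add, map_pow]
  exact Ideal.mul_mem_mul (Ideal.pow_mem_pow (Ideal.subset_span (by simp)) _) hf

lemma C_dvd_of_mem_span {r : R} (hr : r ∈ Ideal.span {π}) : (C π : MvPolynomial (Fin 2) R) ∣ C r := by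
  obtain ⟨s, rfl⟩ := Ideal.mem_span_singleton.1 hr
  exact ⟨C s, by rw [map_mul]⟩

/-- A matrix that is upper triangular modulo `π` preserves the filtration. -/
lemma symRep_mem_symFil {g a : ℕ} {γ : Matrix (Fin 2) (Fin 2) R} (hγ : γ 1 0 ∈ Ideal.span {π})
    {f : Sym R g} (hf : f ∈ symFil π g a) : symRep R g γ f ∈ symFil π g a := by
  rw [mem_symFil, symRep_apply_coe]
  have h : Ideal.map (substAlgHom γ).toRingHom
      (Ideal.span {C π, X 0} : Ideal (MvPolynomial (Fin 2) R)) ≤ Ideal.span {C π, X 0} := by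
    rw [Ideal.map_span, Ideal.span_le]
    rintro _ ⟨f, rfl | rfl, rfl⟩
    · simp only [AlgHom.toRingHom_eq_coe, AlgHom.coe_toRingHom, algHom_C, algebraMap_eq,
        SetLike.mem_coe]
      exact Ideal.subset_span (by simp)
    · simp only [AlgHom.toRingHom_eq_coe, AlgHom.coe_toRingHom, substAlgHom_X, Fin.sum_univ_two,
        SetLike.mem_coe]
      refine Ideal.add_mem _ (Ideal.mul_mem_left _ _ (Ideal.subset_span (by simp))) ?_
      exact Ideal.mul_mem_right _ _ (Ideal.mem_of_dvd _ (C_dvd_of_mem_span hγ)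
        (Ideal.subset_span (by simp)))
  have := Ideal.mem_map_of_mem (substAlgHom γ).toRingHom hf
  rw [Ideal.map_pow] at this
  exact Ideal.pow_right_mono h a this

/-- A matrix with first column divisible by `π` maps the `a`-th step of the filtration
to multiples of `π ^ a`. -/
lemma exists_symRep_eq_pow_smul {g a : ℕ} {α : Matrix (Fin 2) (Fin 2) R}
    (h0 : α 0 0 ∈ Ideal.span {π}) (h1 : α 1 0 ∈ Ideal.span {π})
    {f : Sym R g} (hf : f ∈ symFil π g a) : ∃ h : Sym R g, symRep R g α f = π ^ a • h := by
  have h : Ideal.map (substAlgHom α).toRingHom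
      (Ideal.span {C π, X 0} : Ideal (MvPolynomial (Fin 2) R)) ≤ Ideal.span {C π} := by
    rw [Ideal.map_span, Ideal.span_le]
    rintro _ ⟨f, rfl | rfl, rfl⟩
    · simp only [AlgHom.toRingHom_eq_coe, AlgHom.coe_toRingHom, algHom_C, algebraMap_eq,
        SetLike.mem_coe]
      exact Ideal.subset_span (by simp)
    · simp only [AlgHom.toRingHom_eq_coe, AlgHom.coe_toRingHom, substAlgHom_X, Fin.sum_univ_two,
        SetLike.mem_coe,
        Ideal.mem_span_singleton]
      exact dvd_add ((C_dvd_of_mem_span h0).mul_right _) ((C_dvd_of_mem_span h1).mul_right _)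
  have hmem := Ideal.mem_map_of_mem (substAlgHom α).toRingHom hf
  rw [Ideal.map_pow] at hmem
  have hmem' := Ideal.pow_right_mono h a hmem
  rw [Ideal.span_singleton_pow, Ideal.mem_span_singleton, ← map_pow] at hmem'
  obtain ⟨h, hh⟩ := hmem'
  refine ⟨⟨homogeneousComponent g h, homogeneousComponent_isHomogeneous g h⟩, Subtype.ext ?_⟩
  have hhom := homogeneousComponent_of_mem (symRep R g α f).2 (m := g)
  rw [if_pos rfl] at hhom
  rw [← hhom, Submodule.coe_smul, smul_eq_C_mul, ← homogeneousComponent_C_mul, ← hh]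
  rfl

variable (π)

/-- The filtration of `S_{g,g}` obtained as the tensor product of the filtrations of the factors. -/
def tensFil (g k : ℕ) : Submodule R (Sym R g ⊗[R] Sym R g) :=
  Submodule.span R {z | ∃ a b, a + b = k ∧ ∃ f ∈ symFil π g a, ∃ h ∈ symFil π g b, z = f ⊗ₜ[R] h}

variable {π}

lemma tmul_mem_tensFil {g k a b : ℕ} (hab : a + b = k) {f h : Sym R g} (hf : f ∈ symFil π g a)
    (hh : h ∈ symFil π g b) : f ⊗ₜ[R] h ∈ tensFil π g k :=
  Submodule.subset_span ⟨a, b, hab, f, hf, h, hh, rfl⟩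

lemma symRep₂_tmul (σ : R →+* R) (g : ℕ) (γ : Matrix (Fin 2) (Fin 2) R) (f h : Sym R g) :
    symRep₂ σ g γ (f ⊗ₜ[R] h) = symRep R g γ f ⊗ₜ[R] symRep R g (σ.mapMatrix γ) h := rfl

lemma symRep₂_mem_tensFil (σ : R →+* R) {g k : ℕ} {γ : Matrix (Fin 2) (Fin 2) R}
    (hγ : γ 1 0 ∈ Ideal.span {π}) (hσ : σ (γ 1 0) ∈ Ideal.span {π})
    {z : Sym R g ⊗[R] Sym R g} (hz : z ∈ tensFil π g k) : symRep₂ σ g γ z ∈ tensFil π g k := by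
  have : tensFil π g k ≤ (tensFil π g k).comap (symRep₂ σ g γ) := by
    rw [tensFil, Submodule.span_le]
    rintro _ ⟨a, b, hab, f, hf, h, hh, rfl⟩
    rw [SetLike.mem_coe, Submodule.mem_comap, symRep₂_tmul]
    exact tmul_mem_tensFil hab (symRep_mem_symFil hγ hf) (symRep_mem_symFil hσ hh)
  exact this hz

lemma exists_symRep₂_eq_pow_smul (σ : R →+* R) {g k : ℕ} {α : Matrix (Fin 2) (Fin 2) R}
    (h0 : α 0 0 ∈ Ideal.span {π}) (h1 : α 1 0 ∈ Ideal.span {π})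
    (hσ0 : σ (α 0 0) ∈ Ideal.span {π}) (hσ1 : σ (α 1 0) ∈ Ideal.span {π})
    {z : Sym R g ⊗[R] Sym R g} (hz : z ∈ tensFil π g k) : ∃ w, symRep₂ σ g α z = π ^ k • w := by
  induction hz using Submodule.span_induction with
  | mem z hz =>
    obtain ⟨a, b, hab, f, hf, h, hh, rfl⟩ := hz
    obtain ⟨f', hf'⟩ := exists_symRep_eq_pow_smul h0 h1 hf
    obtain ⟨h', hh'⟩ := exists_symRep_eq_pow_smul (α := σ.mapMatrix α) hσ0 hσ1 hh
    refine ⟨f' ⊗ₜ[R] h', ?_⟩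
    rw [symRep₂_tmul, hf', hh', TensorProduct.smul_tmul_smul, ← pow_add, hab]
  | zero => exact ⟨0, by simp⟩
  | add x y _ _ hx hy =>
    obtain ⟨x', hx'⟩ := hx
    obtain ⟨y', hy'⟩ := hy
    exact ⟨x' + y', by rw [map_add, hx', hy', smul_add]⟩
  | smul r x _ hx =>
    obtain ⟨x', hx'⟩ := hx
    exact ⟨r • x', by rw [map_smul, hx', smul_comm]⟩

lemma mem_symFil_zero {g : ℕ} (f : Sym R g) : f ∈ symFil π g 0 := by simp [mem_symFil]

lemma pow_smul_mem_tensFil {g : ℕ} (k : ℕ) (z : Sym R g ⊗[R] Sym R g) :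
    π ^ k • z ∈ tensFil π g k := by
  induction z using TensorProduct.induction_on with
  | zero => simp
  | tmul f h =>
    rw [TensorProduct.smul_tmul']
    exact tmul_mem_tensFil (a := k + 0) (b := 0) rfl
      (pow_smul_mem_symFil k (mem_symFil_zero f)) (mem_symFil_zero h)
  | add x y hx hy => rw [smul_add]; exact Submodule.add_mem _ hx hy

/-- The monomial `xⁱ y^(g-i)`. -/
def symMonomial (R : Type*) [CommRing R] (g : ℕ) (i : Fin (g + 1)) : Sym R g :=
  ⟨X 0 ^ (i : ℕ) * X 1 ^ (g - i), by
    rw [mem_homogeneousSubmodule]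
    have h := (isHomogeneous_X_pow (R := R) (0 : Fin 2) i).mul
      (isHomogeneous_X_pow (1 : Fin 2) (g - i))
    rwa [Nat.add_sub_cancel' (Nat.lt_succ_iff.1 i.2)] at h⟩

lemma symMonomial_mem_symFil (g : ℕ) (i : Fin (g + 1)) : symMonomial R g i ∈ symFil π g i := by
  rw [mem_symFil]
  exact Ideal.mul_mem_right _ _ (Ideal.pow_mem_pow (Ideal.subset_span (by simp)) _)

lemma span_symMonomial (g : ℕ) : Submodule.span R (Set.range (symMonomial R g)) = ⊤ := by
  rw [eq_top_iff]
  rintro ⟨f, hf⟩ -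
  have key : f ∈ (Submodule.span R (Set.range (symMonomial R g))).map (Submodule.subtype _) := by
    rw [f.as_sum]
    refine Submodule.sum_mem _ fun d hd => ?_
    have hdeg : d 0 + d 1 = g := by
      have := (mem_homogeneousSubmodule _ _).1 hf (mem_support_iff.1 hd)
      rw [Finsupp.weight_apply, Finsupp.sum_fintype _ _ (by simp)] at this
      simpa [Fin.sum_univ_two] using this
    rw [Submodule.map_span]
    have hmon : monomial d (coeff d f) = coeff d f • (X 0 ^ d 0 * X 1 ^ d 1) := by
      rw [monomial_eq, Finsupp.prod_fintype _ _ (by simp), Fin.prod_univ_two, smul_eq_C_mul]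
    rw [hmon]
    refine Submodule.smul_mem _ _ (Submodule.subset_span ⟨symMonomial R g ⟨d 0, by omega⟩,
      ⟨_, rfl⟩, ?_⟩)
    have : g - d 0 = d 1 := by omega
    simp [symMonomial, this]
  obtain ⟨f', hf', h⟩ := key
  rwa [show f' = ⟨f, hf⟩ from Subtype.ext h] at hf'

lemma span_symMonomial_tmul (g : ℕ) :
    Submodule.span R (Set.range fun ij : Fin (g + 1) × Fin (g + 1) =>
      symMonomial R g ij.1 ⊗ₜ[R] symMonomial R g ij.2) = ⊤ := by
  rw [eq_top_iff, ← TensorProduct.map₂_mk_top_top_eq_top, ← span_symMonomial (R := R) g,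
    Submodule.map₂_span_span]
  refine Submodule.span_mono ?_
  rintro _ ⟨_, ⟨i, rfl⟩, _, ⟨j, rfl⟩, rfl⟩
  exact ⟨(i, j), rfl⟩

lemma pow_smul_symMonomial_tmul_mem (g k : ℕ) (i j : Fin (g + 1)) :
    π ^ (k - i - j) • (symMonomial R g i ⊗ₜ[R] symMonomial R g j) ∈ tensFil π g k := by
  rw [TensorProduct.smul_tmul']
  -- With truncated subtraction `b = min j k`, which also covers `i + j > k`.
  refine tmul_mem_tensFil (a := k - j) (b := k - (k - j)) (by omega) ?_ ?_
  · exact symFil_anti g (by omega) (pow_smul_mem_symFil _ (symMonomial_mem_symFil g i))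
  · exact symFil_anti g (by omega) (symMonomial_mem_symFil g j)

lemma sum_tsub_le (g k : ℕ) :
    ∑ ij : Fin (g + 1) × Fin (g + 1), (k - ij.1 - ij.2 : ℕ) ≤ ∑ j ∈ Finset.range (k + 1), j ^ 2 := by
  have h1 : ∀ n g : ℕ, ∑ j ∈ Finset.range g, (n - j) ≤ n ^ 2 := by
    intro n g
    calc ∑ j ∈ Finset.range g, (n - j) ≤ ∑ j ∈ Finset.range g, if j < n then n else 0 := by
          refine Finset.sum_le_sum fun j _ => ?_
          split_ifs <;> omega
      _ = ∑ j ∈ (Finset.range g).filter (· < n), n := by rw [Finset.sum_filter]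
      _ ≤ ∑ j ∈ Finset.range n, n := by
          refine Finset.sum_le_sum_of_subset fun j hj => ?_
          simp only [Finset.mem_filter, Finset.mem_range] at hj ⊢
          exact hj.2
      _ = n ^ 2 := by simp [sq]
  have h2 : ∀ g : ℕ, ∑ i ∈ Finset.range g, (k - i) ^ 2 ≤ ∑ j ∈ Finset.range (k + 1), j ^ 2 := by
    intro g
    calc ∑ i ∈ Finset.range g, (k - i) ^ 2
        ≤ ∑ i ∈ Finset.range g, if i < k + 1 then (k + 1 - 1 - i) ^ 2 else 0 := by
          refine Finset.sum_le_sum fun j _ => ?_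
          split_ifs with h
          · simp
          · simp [show k - j = 0 by omega]
      _ = ∑ i ∈ (Finset.range g).filter (· < k + 1), (k + 1 - 1 - i) ^ 2 := by
          rw [Finset.sum_filter]
      _ ≤ ∑ i ∈ Finset.range (k + 1), (k + 1 - 1 - i) ^ 2 := by
          refine Finset.sum_le_sum_of_subset fun j hj => ?_
          simp only [Finset.mem_filter, Finset.mem_range] at hj ⊢
          exact hj.2
      _ = ∑ j ∈ Finset.range (k + 1), j ^ 2 := Finset.sum_range_reflect (fun j => j ^ 2) (k + 1)
  rw [Fintype.sum_prod_type]
  refine le_trans ?_ (h2 (g + 1))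
  rw [← Fin.sum_univ_eq_sum_range (fun i => (k - i) ^ 2) (g + 1)]
  refine Finset.sum_le_sum fun i _ => ?_
  rw [Fin.sum_univ_eq_sum_range (fun j => k - i - j) (g + 1)]
  exact h1 _ _

/-- A submodule containing `π ^ e_j v_j` for a finite spanning family `v_j` has index at most
`#(R ⧸ π) ^ ∑ e_j`. -/
lemma card_quotient_le_of_pow_smul_mem [IsDedekindDomain R] [Module.Free ℤ R]
    [Module.Finite ℤ R] (hπ : π ≠ 0) {V : Type*} [AddCommGroup V] [Module R V] (M : Submodule R V)
    {κ : Type*} [Fintype κ] (v : κ → V) (hv : Submodule.span R (Set.range v) = ⊤) (e : κ → ℕ)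
    (hM : ∀ j, π ^ e j • v j ∈ M) :
    Finite (V ⧸ M) ∧ Nat.card (V ⧸ M) ≤ Ideal.absNorm (Ideal.span {π}) ^ ∑ j, e j := by
  let I : κ → Ideal R := fun j => Ideal.span {π ^ e j}
  let Q := Submodule.pi Set.univ I
  let Φ : (κ → R) →ₗ[R] V := Fintype.linearCombination R v
  have hΦ : Function.Surjective Φ := by
    rw [← LinearMap.range_eq_top, Fintype.range_linearCombination]
    exact hv
  have hQ : Q ≤ M.comap Φ := by
    intro c hc
    rw [Submodule.mem_comap, Fintype.linearCombination_apply]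
    refine Submodule.sum_mem _ fun j _ => ?_
    obtain ⟨d, hd⟩ := Ideal.mem_span_singleton'.1 (hc j (Set.mem_univ _))
    rw [← hd, mul_smul]
    exact Submodule.smul_mem _ _ (hM j)
  have hsurj : Function.Surjective (Submodule.mapQ Q M Φ hQ) := by
    intro z
    obtain ⟨z, rfl⟩ := Submodule.mkQ_surjective _ z
    obtain ⟨c, rfl⟩ := hΦ z
    exact ⟨Submodule.Quotient.mk c, rfl⟩
  classical
  have hfinI : ∀ j, Finite (R ⧸ I j) := fun j =>
    Ideal.finiteQuotientOfFreeOfNeBot _ (by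
      rw [Ne, Ideal.span_singleton_eq_bot]
      exact pow_ne_zero _ hπ)
  have hfin : Finite ((κ → R) ⧸ Q) := Finite.of_equiv _ (Submodule.quotientPi I).symm.toEquiv
  refine ⟨Finite.of_surjective _ hsurj, (Nat.card_le_card_of_surjective _ hsurj).trans ?_⟩
  rw [Nat.card_congr (Submodule.quotientPi I).toEquiv, Nat.card_pi]
  have hnorm : ∀ j, Nat.card (R ⧸ I j) = Ideal.absNorm (Ideal.span {π}) ^ e j := by
    intro j
    rw [← map_pow, Ideal.span_singleton_pow]
    rfl
  rw [Finset.prod_congr rfl fun j _ => hnorm j, Finset.prod_pow_eq_pow_sum]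

end Filtration

/-! ### Cocycles with values in a submodule -/

section Cocycles

open groupCohomology

universe u

variable {k Γ : Type u} [CommRing k] [Group Γ] (A : Rep.{u} k Γ) (M : Submodule k A)

/-- The cocycles of `Γ` in `A` with values in `M`. -/
def cocyclesIn : Submodule k (cocycles₁ A) where
  carrier := {φ | ∀ δ, φ δ ∈ M}
  add_mem' hφ hψ δ := M.add_mem (hφ δ) (hψ δ)
  zero_mem' _ := M.zero_mem
  smul_mem' c _ hφ δ := M.smul_mem c (hφ δ)

variable {A M}

/-- Modulo a stable submodule `M`, a cocycle is determined by its values on generators. -/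
lemma card_quotient_cocyclesIn_le (hM : ∀ δ, ∀ x ∈ M, A.ρ δ x ∈ M) {m : ℕ} (s : Fin m → Γ)
    (hs : Subgroup.closure (Set.range s) = ⊤) [Finite (A ⧸ M)] :
    Finite (cocycles₁ A ⧸ cocyclesIn A M) ∧
      Nat.card (cocycles₁ A ⧸ cocyclesIn A M) ≤ Nat.card (A ⧸ M) ^ m := by
  let ev : cocycles₁ A →ₗ[k] (Fin m → A ⧸ M) :=
    LinearMap.pi fun i => M.mkQ ∘ₗ LinearMap.proj (s i) ∘ₗ (cocycles₁ A).subtype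
  have hker : ∀ φ, ev φ = 0 → φ ∈ cocyclesIn A M := by
    intro φ hφ δ
    have hδ : δ ∈ Subgroup.closure (Set.range s) := by rw [hs]; trivial
    have hmul := (mem_cocycles₁_iff φ.1).1 φ.2
    have hone : φ.1 1 = 0 := cocycles₁_map_one φ
    change φ.1 δ ∈ M
    induction hδ using Subgroup.closure_induction with
    | mem x hx =>
      obtain ⟨i, rfl⟩ := hx
      exact (Submodule.Quotient.mk_eq_zero M).1 (congrFun hφ i)
    | one => rw [hone]; exact M.zero_mem
    | mul x y _ _ hx hy => rw [hmul]; exact M.add_mem (hM x _ hy) hx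
    | inv x _ hx =>
      have := hmul x⁻¹ x
      rw [inv_mul_cancel, hone] at this
      rw [← neg_eq_of_add_eq_zero_right this.symm]
      exact M.neg_mem (hM _ _ hx)
  let ev' := (cocyclesIn A M).liftQ ev (fun φ hφ => by
    rw [LinearMap.mem_ker]
    funext i
    exact (Submodule.Quotient.mk_eq_zero M).2 (hφ (s i)))
  have hinj : Function.Injective ev' := by
    rw [← LinearMap.ker_eq_bot, LinearMap.ker_eq_bot']
    intro z hz
    obtain ⟨φ, rfl⟩ := Submodule.mkQ_surjective _ z
    exact (Submodule.Quotient.mk_eq_zero _).2 (hker φ hz)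
  refine ⟨Finite.of_injective _ hinj, (Nat.card_le_card_of_injective _ hinj).trans ?_⟩
  rw [Nat.card_fun, Nat.card_fin]

/-- If an operator on cochains maps the values in `M` into `c A` and `A` is torsion-free, then it
maps cocycles with values in `M` to `c` times a cocycle. -/
lemma exists_cocycle_eq_smul {F : (Γ → A) →ₗ[k] (Γ → A)}
    (hZ : ∀ φ ∈ cocycles₁ A, F φ ∈ cocycles₁ A) {c : k}
    (hc : Function.Injective fun x : A => c • x)
    (hF : ∀ φ : Γ → A, (∀ δ, φ δ ∈ M) → ∀ δ, ∃ y, F φ δ = c • y)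
    {φ : cocycles₁ A} (hφ : φ ∈ cocyclesIn A M) :
    ∃ ψ : cocycles₁ A, F.restrict hZ φ = c • ψ := by
  choose ψ hψ using hF φ.1 hφ
  have hψ' : F φ.1 = c • ψ := funext hψ
  have hmul := (mem_cocycles₁_iff _).1 (hZ φ.1 φ.2)
  refine ⟨⟨ψ, (mem_cocycles₁_iff _).2 fun δ ε => hc ?_⟩, Subtype.ext hψ'⟩
  have := hmul δ ε
  rw [hψ, hψ, hψ, map_smul, ← smul_add] at this
  exact this

/-- Suppose that the operator `F` maps cochains with values in a stable submodule `M` of `A` into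
`π ^ r` times cochains, and that `M` contains `π ^ r A` and, for a spanning family `v_j` of `A`,
the elements `π ^ e_j v_j`, so that its index is at most `#(k ⧸ π) ^ ℓ` if `∑ e_j ≤ ℓ`. For `m`
generators of `Γ`, the classes of the cocycles with values in `M` form a submodule of
index at most `#(k ⧸ π) ^ (m ℓ)` of the torsion-free quotient of `H¹(Γ, A)`, whose image under the
operator induced by `F` is divisible by `π ^ r`. -/
theorem pow_dvd_coeff_charpoly_of_cochains [IsDomain k] [IsPrincipalIdealRing k] [Module.Free ℤ k]
    [Module.Finite ℤ k] [Module.IsTorsionFree k A] {F : (Γ → A) →ₗ[k] (Γ → A)}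
    (hZ : ∀ φ ∈ cocycles₁ A, F φ ∈ cocycles₁ A)
    (hB : ∀ φ ∈ coboundaries₁ A, F φ ∈ coboundaries₁ A)
    [Module.Finite k (H1 A ⧸ Submodule.torsion k (H1 A))]
    (T : (H1 A ⧸ Submodule.torsion k (H1 A)) →ₗ[k] (H1 A ⧸ Submodule.torsion k (H1 A)))
    (hT : ∀ x, T (Submodule.mkQ _ x) = Submodule.mkQ _ (endH1 A F hZ hB x))
    (hM : ∀ δ, ∀ x ∈ M, A.ρ δ x ∈ M) {π : k} (hπ : Prime π) {r ℓ : ℕ}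
    (hr : ∀ x : A, π ^ r • x ∈ M)
    (hF : ∀ φ : Γ → A, (∀ δ, φ δ ∈ M) → ∀ δ, ∃ y, F φ δ = π ^ r • y)
    {κ : Type*} [Fintype κ] (v : κ → A) (hv : Submodule.span k (Set.range v) = ⊤) (e : κ → ℕ)
    (hvM : ∀ j, π ^ e j • v j ∈ M) (he : ∑ j, e j ≤ ℓ) {m : ℕ} (s : Fin m → Γ)
    (hs : Subgroup.closure (Set.range s) = ⊤) {i : ℕ}
    (hi : i ≤ Module.finrank k (H1 A ⧸ Submodule.torsion k (H1 A))) :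
    π ^ (r * i) ∣ π ^ (m * ℓ) *
      T.charpoly.coeff (Module.finrank k (H1 A ⧸ Submodule.torsion k (H1 A)) - i) := by
  obtain ⟨hfin, hcard⟩ := card_quotient_le_of_pow_smul_mem hπ.ne_zero M v hv e hvM
  obtain ⟨hfin', hcard'⟩ := card_quotient_cocyclesIn_le hM s hs
  set Z := cocyclesIn A M
  let q : cocycles₁ A →ₗ[k] (H1 A ⧸ Submodule.torsion k (H1 A)) :=
    (Submodule.mkQ _) ∘ₗ (H1π A).hom
  have hq : Function.Surjective q := (Submodule.mkQ_surjective _).comp (H1π_surjective A)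
  refine prime_pow_dvd_coeff_charpoly T (Z.map q) hπ r _ ?_ ?_ ?_ hi
  · intro x
    obtain ⟨φ, rfl⟩ := hq x
    exact ⟨π ^ r • φ, fun δ => hr (φ.1 δ), map_smul _ _ _⟩
  · rintro _ ⟨φ, hφ, rfl⟩
    obtain ⟨ψ, hψ⟩ := exists_cocycle_eq_smul hZ
      (smul_right_injective _ (pow_ne_zero r hπ.ne_zero)) hF hφ
    refine ⟨q ψ, ?_⟩
    rw [← map_smul, ← hψ]
    exact (hT _).trans (congrArg _ (endH1_H1π A F hZ hB φ))
  · have hsurj : Function.Surjective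
        (Submodule.mapQ Z (Z.map q) q (Submodule.le_comap_map q Z)) := by
      intro z
      obtain ⟨z, rfl⟩ := Submodule.mkQ_surjective _ z
      obtain ⟨φ, rfl⟩ := hq z
      exact ⟨Submodule.Quotient.mk φ, rfl⟩
    refine (Nat.card_le_card_of_surjective _ hsurj).trans (hcard'.trans ?_)
    rw [mul_comm, pow_mul]
    have hpos : 0 < Ideal.absNorm (Ideal.span {π}) := by
      rw [Nat.pos_iff_ne_zero, Ne, Ideal.absNorm_eq_zero_iff, Ideal.span_singleton_eq_bot]
      exact hπ.ne_zero
    exact Nat.pow_le_pow_left (hcard.trans (Nat.pow_le_pow_right hpos he)) m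

end Cocycles

/-! ### The Hecke operator on the space of forms -/

section Hecke

open NumberField groupCohomology

universe u

variable (K : Type u) [Field K] [NumberField K] (N : 𝓞 K) (p : ℕ)

section
variable [Algebra.IsQuadraticExtension ℚ K] [IsTotallyComplex K]

lemma conj_mem_span_natCast {x : 𝓞 K} (hx : x ∈ Ideal.span {(p : 𝓞 K)}) :
    conj K x ∈ Ideal.span {(p : 𝓞 K)} := by
  obtain ⟨y, rfl⟩ := Ideal.mem_span_singleton.1 hx
  rw [map_mul, map_natCast]
  exact Ideal.mul_mem_right _ _ (Ideal.mem_span_singleton_self _)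

/-- The filtration step `tensFil`, as a submodule of the representation `weightRep`. -/
def weightFil (g k : ℕ) : Submodule (𝓞 K) (weightRep K N p g) := tensFil (p : 𝓞 K) g k

lemma weightRep_mem_weightFil (g k : ℕ) (δ : level K N p) (x : weightRep K N p g)
    (hx : x ∈ weightFil K N p g k) : (weightRep K N p g).ρ δ x ∈ weightFil K N p g k := by
  have h : levelToMatrix K N p δ 1 0 ∈ Ideal.span {(p : 𝓞 K)} :=
    Ideal.span_singleton_le_span_singleton.2 (Dvd.intro_left N rfl) δ.2.1
  exact symRep₂_mem_tensFil (conj K) h (conj_mem_span_natCast K p h) hx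

lemma pow_smul_mem_weightFil (g k : ℕ) (x : weightRep K N p g) :
    (p : 𝓞 K) ^ k • x ∈ weightFil K N p g k :=
  pow_smul_mem_tensFil k x

/-- The monomials `xⁱ y^(g-i) ⊗ xʲ y^(g-j)`, as elements of the representation `weightRep`. -/
def weightMonomial (g : ℕ) (ij : Fin (g + 1) × Fin (g + 1)) : weightRep K N p g :=
  symMonomial (𝓞 K) g ij.1 ⊗ₜ[𝓞 K] symMonomial (𝓞 K) g ij.2

lemma span_weightMonomial (g : ℕ) :
    Submodule.span (𝓞 K) (Set.range (weightMonomial K N p g)) = ⊤ :=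
  span_symMonomial_tmul g

lemma pow_smul_weightMonomial_mem (g k : ℕ) (ij : Fin (g + 1) × Fin (g + 1)) :
    (p : 𝓞 K) ^ (k - ij.1 - ij.2 : ℕ) • weightMonomial K N p g ij ∈ weightFil K N p g k :=
  pow_smul_symMonomial_tmul_mem g k ij.1 ij.2

lemma isTorsionFree_weightRep [IsPrincipalIdealRing (𝓞 K)] (g : ℕ) :
    Module.IsTorsionFree (𝓞 K) (weightRep K N p g) := by
  have hSym : Module.Finite (𝓞 K) (Sym (𝓞 K) g) :=
    Module.Finite.iff_fg.2 (MvPolynomial.homogeneousSubmodule_fg (Fin 2) (𝓞 K) g)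
  exact inferInstanceAs (Module.IsTorsionFree (𝓞 K) (Sym (𝓞 K) g ⊗[𝓞 K] Sym (𝓞 K) g))

variable [Fact p.Prime]

lemma heckeFun_eq_pow_smul (g k : ℕ) (φ : level K N p → weightRep K N p g)
    (hφ : ∀ δ, φ δ ∈ weightFil K N p g k) (δ : level K N p) :
    ∃ y, heckeFun (weightAct K g) (heckeMat K p) swapElt φ δ = (p : 𝓞 K) ^ k • y := by
  have h0 : ∀ u, heckeMat K p u 0 0 ∈ Ideal.span {(p : 𝓞 K)} := fun u =>
    Ideal.mem_span_singleton_self _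
  have h1 : ∀ u, heckeMat K p u 1 0 ∈ Ideal.span {(p : 𝓞 K)} := fun u => Ideal.zero_mem _
  choose y hy using fun u => exists_symRep₂_eq_pow_smul (conj K) (h0 u) (h1 u)
    (conj_mem_span_natCast K p (h0 u)) (conj_mem_span_natCast K p (h1 u)) (hφ (swapElt δ u))
  refine ⟨∑ u, y u, ?_⟩
  rw [heckeFun_apply, Finset.smul_sum]
  exact Finset.sum_congr rfl fun u _ => hy u

lemma heckeT_mkQ (g : ℕ) (x : H1 (weightRep K N p g)) :
    heckeT K N p g (Submodule.mkQ _ x) = Submodule.mkQ _ (heckeH1 K N p g x) := rfl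

/-- The bound on the coefficients of the characteristic polynomial of `T_p`, from the action
of the matrices `α_u` on the `k`-th filtration step. -/
theorem pow_dvd_coeff_charpoly_heckeT [IsPrincipalIdealRing (𝓞 K)] (hinert : Prime (p : 𝓞 K))
    [Group.FG (level K N p)] {m : ℕ} (s : Fin m → level K N p)
    (hs : Subgroup.closure (Set.range s) = ⊤) (g k : ℕ) {i : ℕ}
    (hi : i ≤ Module.finrank (𝓞 K) (Forms K N p g)) :
    (p : 𝓞 K) ^ (k * i) ∣ (p : 𝓞 K) ^ (m * ∑ j ∈ Finset.range (k + 1), j ^ 2) *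
      (heckeT K N p g).charpoly.coeff (Module.finrank (𝓞 K) (Forms K N p g) - i) :=
  have := isTorsionFree_weightRep K N p g
  pow_dvd_coeff_charpoly_of_cochains (A := weightRep K N p g) (M := weightFil K N p g k)
    (heckeFun_mem_cocycles swap_spec swap_mul swapIdx_bijective)
    (heckeFun_mem_coboundaries swap_spec swapIdx_bijective)
    (heckeT K N p g) (heckeT_mkQ K N p g) (weightRep_mem_weightFil K N p g k) hinert
    (pow_smul_mem_weightFil K N p g k) (heckeFun_eq_pow_smul K N p g k)
    (weightMonomial K N p g) (span_weightMonomial K N p g) (fun ij => k - ij.1 - ij.2)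
    (pow_smul_weightMonomial_mem K N p g k) (sum_tsub_le g k) s hs hi

end

/-- `Γ₁(Np)` contains non-commuting unipotent matrices, so one element does not generate it. -/
lemma two_le_of_closure_eq_top {N : 𝓞 K} (hN : N ≠ 0) (hp : (p : 𝓞 K) ≠ 0) {m : ℕ}
    (s : Fin m → level K N p) (hs : Subgroup.closure (Set.range s) = ⊤) : 2 ≤ m := by
  by_contra! hm
  have : Subsingleton (Fin m) := Fin.subsingleton_iff_le_one.2 (by omega)
  have hcomm : ∀ a b : level K N p, a * b = b * a := by
    intro a b
    have hab : ∀ x : level K N p, x ∈ Subgroup.closure (Set.range s) := fun x => by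
      rw [hs]; trivial
    refine Subgroup.closure_induction₂ (p := fun a b _ _ => a * b = b * a) ?_ ?_ ?_ ?_ ?_ ?_ ?_
      (hab a) (hab b)
    · rintro _ _ ⟨i, rfl⟩ ⟨j, rfl⟩
      rw [Subsingleton.elim i j]
    · simp
    · simp
    · intro x y z _ _ _ h1 h2; exact Commute.mul_left h1 h2
    · intro x y z _ _ _ h1 h2; exact Commute.mul_right h1 h2
    · intro x y _ _ h; exact Commute.inv_left h
    · intro x y _ _ h; exact Commute.inv_right h
  set n : 𝓞 K := N * p with hn
  have hn0 : n ≠ 0 := mul_ne_zero hN hp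
  let U : SL(2, 𝓞 K) := ⟨!![1, n; 0, 1], by simp⟩
  let V : SL(2, 𝓞 K) := ⟨!![1, 0; n, 1], by simp⟩
  have hU : U ∈ level K N p := by
    change _ ∧ _ ∧ _
    simp [U]
  have hV : V ∈ level K N p := by
    change _ ∧ _ ∧ _
    simp [V, hn]
  have h : U * V = V * U := congrArg Subtype.val (hcomm ⟨U, hU⟩ ⟨V, hV⟩)
  have h' := congrFun (congrFun (congrArg Subtype.val h) 0) 0
  rw [Matrix.SpecialLinearGroup.coe_mul, Matrix.SpecialLinearGroup.coe_mul] at h'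
  simp [U, V, Matrix.mul_apply, Fin.sum_univ_two] at h'
  exact hn0 h'

end Hecke

end Bianchi

end

theorem mainTheorem2 (K : Type*) [Field K] [NumberField K]
    [Algebra.IsQuadraticExtension ℚ K] [NumberField.IsTotallyComplex K]
    (hcl : NumberField.classNumber K = 1)
    (p : ℕ) [Fact p.Prime] (hodd : p ≠ 2) (hinert : Prime (p : NumberField.RingOfIntegers K))
    (N : NumberField.RingOfIntegers K) (hN : N ≠ 0)
    [Group.FG (Bianchi.level K N p)]
    (m : ℕ) (s : Fin m → Bianchi.level K N p) (hs : Subgroup.closure (Set.range s) = ⊤)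
    (ι : K →+* PadicAlgCl p) (g : ℕ) :
    (∀ q ∈ Bianchi.newtonPolygon ((Bianchi.heckePoly K N p g).map ι),
      Bianchi.lowerBound m q.1 ≤ q.2) ∧
    (∀ α : ℝ, 0 ≤ α →
      Bianchi.slopeCount ((Bianchi.heckePoly K N p g).map ι) α <
        ⌊3 * (m : ℝ) * (α + 1) ^ 2 / 2⌋₊ * m) := by
  have hpid : IsPrincipalIdealRing (NumberField.RingOfIntegers K) :=
    NumberField.classNumber_eq_one_iff.1 hcl
  have hm : 2 ≤ m := Bianchi.two_le_of_closure_eq_top K p hN hinert.ne_zero s hs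
  set T := Bianchi.heckeT K N p g
  have hpoly : Bianchi.heckePoly K N p g = T.charpoly.map (algebraMap _ K) :=
    LinearMap.charpoly_baseChange _ _
  have hmonic : ((Bianchi.heckePoly K N p g).map ι).Monic := by
    rw [hpoly]
    exact (T.charpoly_monic.map _).map _
  have hdeg : ((Bianchi.heckePoly K N p g).map ι).natDegree =
      Module.finrank (NumberField.RingOfIntegers K) (Bianchi.Forms K N p g) := by
    rw [hpoly, (T.charpoly_monic.map _).natDegree_map, T.charpoly_monic.natDegree_map,
      T.charpoly_natDegree]
  have H : ∀ k i : ℕ, i ≤ ((Bianchi.heckePoly K N p g).map ι).natDegree →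
      ((Bianchi.heckePoly K N p g).map ι).coeff
        (((Bianchi.heckePoly K N p g).map ι).natDegree - i) ≠ 0 →
      (k : ℝ) * i - m * ∑ j ∈ Finset.range (k + 1), (j : ℝ) ^ 2 ≤
        Bianchi.val (((Bianchi.heckePoly K N p g).map ι).coeff
          (((Bianchi.heckePoly K N p g).map ι).natDegree - i)) := by
    rw [hdeg]
    intro k i hi h0
    rw [hpoly, Polynomial.coeff_map, Polynomial.coeff_map] at h0 ⊢
    have := Bianchi.sub_le_val_of_pow_dvd ι
      (Bianchi.pow_dvd_coeff_charpoly_heckeT K N p hinert s hs g k hi) h0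
    push_cast at this
    exact this
  exact ⟨fun q hq => Bianchi.lowerBound_le_of_mem_newtonPolygon H hq,
    fun α hα => Bianchi.slopeCount_lt hm hmonic H hα⟩
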